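/- Let $N\ge 1$ be an integer, $0<s<1$, $p>1$ with $ps<N$, let $-ps<\beta<\frac{N-ps}{2}$ and put $\alpha=-\frac{2\beta}{p}$. For a measurable $u:\mathbb{R}^N\to\mathbb{R}$ write $$[u]_{\beta}=\Big(\iint_{\mathbb{R}^{2N}}\frac{|u(x)-u(y)|^p}{|x-y|^{N+ps}}\,\frac{dx\,dy}{|x|^{\beta}|y|^{\beta}}\Big)^{1/p},\qquad \|u\|_{L^p_\beta}=\Big(\int_{\mathbb{R}^N}\frac{|u(x)|^p}{|x|^{2\beta}}\,dx\Big)^{1/p}.$$ Let $D^{s,p}_\beta(\mathbb{R}^N)$ be the completion of $C_0^\infty(\mathbb{R}^N)$ with respect to $[\,\cdot\,]_\beta$, realised as a space of functions: $u\in D^{s,p}_\beta(\mathbb{R}^N)$ if and only if $u$ is measurable, $[u]_\beta<\infty$, and there are $\varphi_n\in C_0^\infty(\mathbb{R}^N)$ with $[\varphi_n-u]_\beta\to0$ and $\varphi_n\to u$ almost everywhere. Put $D^{s,p}(\mathbb{R}^N)=D^{s,p}_0(\mathbb{R}^N)$, and let $$E_\alpha(\mathbb{R}^N)=\{u:\ |x|^\alpha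 u\in D^{s,p}(\mathbb{R}^N)\},\qquad \|u\|_{E_\alpha}=\big[\,|x|^\alpha u\,\big]_0,$$ $$W^{s,p}_\beta(\mathbb{R}^N)=\{u \text{ measurable}:\ \|u\|_{L^p_\beta}<\infty,\ [u]_\beta<\infty\},\qquad \|u\|_{W^{s,p}_\beta}=\|u\|_{L^p_\beta}+[u]_\beta.$$ Then the homogeneous weighted fractional Sobolev space with measure $\frac{dx\,dy}{|x|^\beta|y|^\beta}$ coincides with $E_\alpha$: $$D^{s,p}_\beta(\mathbb{R}^N)=E_\alpha(\mathbb{R}^N),$$ and there are constants $C_1,C_2>0$, depending only on $N,s,p,\beta$, such that $$C_1\|u\|_{E_\alpha}\le[u]_\beta\le C_2\|u\|_{E_\alpha}\qquad\text{for all }u\in E_\alpha(\mathbb{R}^N).$$ Correspondingly, for the inhomogeneous space, $$W^{s,p}_\beta(\mathbb{R}^N)=\{u\in E_\alpha(\mathbb{R}^N):\ \|u\|_{L^p_\beta}<\infty\},$$ and there are constants $C_1',C_2'>0$, depending only on $N,s,p,\beta$, such that $$C_1'\big(\|u\|_{L^p_\beta}+\|u\|_{E_\alpha}\big)\le\|u\|_{W^{s,p}_\beta}\le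 C_2'\big(\|u\|_{L^p_\beta}+\|u\|_{E_\alpha}\big)\qquad\text{for all }u\in W^{s,p}_\beta(\mathbb{R}^N).$$ -/

import Mathlib

open MeasureTheory Filter Topology
open scoped ENNReal ContDiff

noncomputable section

namespace FracSobolev

/-- The space of test functions `C₀^∞(ℝ^N)`. -/
def testFunctions (N : ℕ) : Set (EuclideanSpace ℝ (Fin N) → ℝ) :=
  {φ | ContDiff ℝ ∞ φ ∧ HasCompactSupport φ}

/-- The weighted Gagliardo energy
`∬ |u(x) - u(y)|^p / |x - y|^(N + p s) dx dy / (|x|^β |y|^β)`, with values in `[0, ∞]`. -/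
def energy (N : ℕ) (s p β : ℝ) (u : EuclideanSpace ℝ (Fin N) → ℝ) : ℝ≥0∞ :=
  ∫⁻ x, ∫⁻ y, ENNReal.ofReal
    (|u x - u y| ^ p / ‖x - y‖ ^ ((N : ℝ) + p * s) * (1 / (‖x‖ ^ β * ‖y‖ ^ β)))

/-- The homogeneous weighted norm, the `p`-th root of the energy. It is only used for functions
of finite energy. -/
def seminorm (N : ℕ) (s p β : ℝ) (u : EuclideanSpace ℝ (Fin N) → ℝ) : ℝ :=
  (energy N s p β u).toReal ^ (1 / p)

/-- `∫ |u(x)|^p dx / |x|^(2β)`, with values in `[0, ∞]`. -/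
def lpEnergy (N : ℕ) (p β : ℝ) (u : EuclideanSpace ℝ (Fin N) → ℝ) : ℝ≥0∞ :=
  ∫⁻ x, ENNReal.ofReal (|u x| ^ p / ‖x‖ ^ (2 * β))

/-- The norm of `L^p(ℝ^N, dx / |x|^(2β))`. It is only used for functions of finite `lpEnergy`. -/
def lpNorm (N : ℕ) (p β : ℝ) (u : EuclideanSpace ℝ (Fin N) → ℝ) : ℝ :=
  (lpEnergy N p β u).toReal ^ (1 / p)

/-- The space `D^{s,p}_β(ℝ^N)`: the completion of `C₀^∞(ℝ^N)` for the homogeneous weighted norm,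
realised as a space of functions. Its elements are the measurable functions of finite energy that
are the limit, both in the homogeneous norm and almost everywhere, of a sequence of test functions.
(The convergence almost everywhere pins down the function; the homogeneous norm alone does not see
additive constants.) Functions that agree almost everywhere are elements together. -/
def spaceD (N : ℕ) (s p β : ℝ) : Set (EuclideanSpace ℝ (Fin N) → ℝ) :=
  {u | AEStronglyMeasurable u volume ∧ energy N s p β u < ⊤ ∧
    ∃ φ : ℕ → EuclideanSpace ℝ (Fin N) → ℝ,
      (∀ n, φ n ∈ testFunctions N) ∧
      Tendsto (fun n => energy N s p β (fun x => φ n x - u x)) atTop (𝓝 0) ∧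
      ∀ᵐ x, Tendsto (fun n => φ n x) atTop (𝓝 (u x))}

/-- The space `W^{s,p}_β(ℝ^N)`: the functions of `L^p(ℝ^N, dx / |x|^(2β))` of finite weighted
Gagliardo energy. -/
def spaceW (N : ℕ) (s p β : ℝ) : Set (EuclideanSpace ℝ (Fin N) → ℝ) :=
  {u | AEStronglyMeasurable u volume ∧ lpEnergy N p β u < ⊤ ∧ energy N s p β u < ⊤}

/-- The full norm of `W^{s,p}_β(ℝ^N)`. -/
def normW (N : ℕ) (s p β : ℝ) (u : EuclideanSpace ℝ (Fin N) → ℝ) : ℝ :=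
  lpNorm N p β u + seminorm N s p β u

/-- The space `E_α(ℝ^N)` of the functions `u` with `|x|^α u ∈ D^{s,p}(ℝ^N)`. -/
def spaceE (N : ℕ) (s p α : ℝ) : Set (EuclideanSpace ℝ (Fin N) → ℝ) :=
  {u | (fun x => ‖x‖ ^ α * u x) ∈ spaceD N s p 0}

/-- The norm of `E_α(ℝ^N)`. -/
def normE (N : ℕ) (s p α : ℝ) (u : EuclideanSpace ℝ (Fin N) → ℝ) : ℝ :=
  seminorm N s p 0 (fun x => ‖x‖ ^ α * u x)

end FracSobolev

end

open MeasureTheory Filter Topology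
open scoped ENNReal ContDiff

noncomputable section

namespace FracSobolev

/-! Put v = |x|^α u and δ = -β/p, so that α = 2δ. The weighted difference quotient of u and the
unweighted one of v differ, up to the factor |x-y|^(-(N/p+s)), by v(x)((|y|/|x|)^δ - 1) minus the
same expression with x and y exchanged. The factor (|y|/|x|)^δ - 1 vanishes linearly at the
diagonal, which suffices because s < 1; far away it is at most 1 + (|y|/|x|)^δ, and the integral in
y converges when -N < δp < ps. Integrating in y first, the L^p norm of the difference is at most a
constant times the Hardy norm (∫ |v|^p / |x|^(ps))^(1/p), which is the same quantity as the weighted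
Hardy norm of u (`exists_eLpNorm'_gagliardo_sub_le`).

The two energies are therefore comparable once each of them controls this Hardy norm. That is the
fractional Hardy inequality, valid for β < (N-ps)/2 (`exists_hardy_of_lpFun`): u(x) is compared with
u(y) on the shell a|x| < |y| ≤ 2a|x|, and for large a the contribution of u(y) is absorbed. It
extends from test functions to the completion by Fatou's lemma.

For the equality of spaces, the completion is identified with the functions of finite energy and
finite Hardy norm (`mem_spaceD_iff`), a condition that passes from u to v and back. The hard
direction is density. For v without weights, cutting off near 0 and infinity and then mollifying
gives test functions that vanish near 0; multiplying them by |x|^(2β/p) keeps them smooth and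
returns to u. For the inhomogeneous space, finiteness of the L^p norm gives the Hardy inequality
directly. -/

/-! ### Energies rewritten as L^p norms of linear expressions in u. -/

/-- The function whose `p`-th power has integral the weighted Gagliardo energy. -/
def gagliardo (N : ℕ) (s p β : ℝ) (u : EuclideanSpace ℝ (Fin N) → ℝ)
    (z : EuclideanSpace ℝ (Fin N) × EuclideanSpace ℝ (Fin N)) : ℝ :=
  (u z.1 - u z.2) * (‖z.1‖ ^ (-β / p) * ‖z.2‖ ^ (-β / p) * ‖z.1 - z.2‖ ^ (-((N : ℝ) / p + s)))

/-- The function whose `p`-th power is integrated on the left-hand side of the Hardy inequality. -/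
def hardyFun (N : ℕ) (s p β : ℝ) (u : EuclideanSpace ℝ (Fin N) → ℝ)
    (x : EuclideanSpace ℝ (Fin N)) : ℝ :=
  u x * ‖x‖ ^ (-(s + 2 * β / p))

/-- The function whose `p`-th power has integral `lpEnergy`. -/
def lpFun (N : ℕ) (p β : ℝ) (u : EuclideanSpace ℝ (Fin N) → ℝ)
    (x : EuclideanSpace ℝ (Fin N)) : ℝ :=
  u x * ‖x‖ ^ (-2 * β / p)

variable {N : ℕ} {s p β : ℝ}

lemma ofReal_abs_rpow (a : ℝ) (hp : 0 ≤ p) : ENNReal.ofReal (|a| ^ p) = ‖a‖ₑ ^ p := by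
  rw [Real.enorm_eq_ofReal_abs, ENNReal.ofReal_rpow_of_nonneg (abs_nonneg a) hp]

lemma aestronglyMeasurable_gagliardo {u : EuclideanSpace ℝ (Fin N) → ℝ}
    (hu : AEStronglyMeasurable u volume) :
    AEStronglyMeasurable (gagliardo N s p β u) volume := by
  unfold gagliardo
  rw [Measure.volume_eq_prod]
  refine ((hu.comp_fst).sub (hu.comp_snd)).mul (Measurable.aestronglyMeasurable ?_)
  fun_prop

lemma aestronglyMeasurable_hardyFun {u : EuclideanSpace ℝ (Fin N) → ℝ}
    (hu : AEStronglyMeasurable u volume) :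
    AEStronglyMeasurable (hardyFun N s p β u) volume :=
  hu.mul (Measurable.aestronglyMeasurable (by fun_prop))

lemma aestronglyMeasurable_lpFun {u : EuclideanSpace ℝ (Fin N) → ℝ}
    (hu : AEStronglyMeasurable u volume) :
    AEStronglyMeasurable (lpFun N p β u) volume :=
  hu.mul (Measurable.aestronglyMeasurable (by fun_prop))

lemma energy_eq (hp : 0 < p) {u : EuclideanSpace ℝ (Fin N) → ℝ}
    (hu : AEStronglyMeasurable u volume) :
    energy N s p β u = eLpNorm' (gagliardo N s p β u) p volume ^ p := by
  rw [← lintegral_rpow_enorm_eq_rpow_eLpNorm' hp, Measure.volume_eq_prod, lintegral_prod]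
  · refine lintegral_congr fun x => lintegral_congr fun y => ?_
    rw [← ofReal_abs_rpow _ hp.le, gagliardo]
    congr 1
    have h1 := norm_nonneg x
    have h2 := norm_nonneg y
    have h3 := norm_nonneg (x - y)
    have h4 : 0 ≤ ‖x‖ ^ (-β / p) * ‖y‖ ^ (-β / p) * ‖x - y‖ ^ (-((N : ℝ) / p + s)) := by
      positivity
    dsimp only
    rw [abs_mul, Real.mul_rpow (by positivity) (by positivity), abs_of_nonneg h4,
      Real.mul_rpow (by positivity) (by positivity), Real.mul_rpow (by positivity) (by positivity),
      ← Real.rpow_mul h1, ← Real.rpow_mul h2, ← Real.rpow_mul h3]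
    have e1 : -β / p * p = -β := by field_simp
    have e2 : -((N : ℝ) / p + s) * p = -((N : ℝ) + p * s) := by field_simp
    rw [e1, e2, Real.rpow_neg h1, Real.rpow_neg h2, Real.rpow_neg h3]
    simp only [div_eq_mul_inv, mul_inv]
    ring
  · rw [← Measure.volume_eq_prod]
    exact (aestronglyMeasurable_gagliardo hu).enorm.pow_const _

lemma lpEnergy_eq (hp : 0 < p) (u : EuclideanSpace ℝ (Fin N) → ℝ) :
    lpEnergy N p β u = eLpNorm' (lpFun N p β u) p volume ^ p := by
  rw [← lintegral_rpow_enorm_eq_rpow_eLpNorm' hp]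
  refine lintegral_congr fun x => ?_
  rw [← ofReal_abs_rpow _ hp.le, lpFun]
  have h1 := norm_nonneg x
  rw [abs_mul, Real.mul_rpow (by positivity) (by positivity),
    abs_of_nonneg (Real.rpow_nonneg h1 _), ← Real.rpow_mul h1]
  have e1 : -2 * β / p * p = -(2 * β) := by field_simp
  rw [e1, Real.rpow_neg h1, div_eq_mul_inv]

lemma seminorm_eq (hp : 0 < p) {u : EuclideanSpace ℝ (Fin N) → ℝ}
    (hu : AEStronglyMeasurable u volume) :
    seminorm N s p β u = (eLpNorm' (gagliardo N s p β u) p volume).toReal := by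
  rw [seminorm, energy_eq hp hu, ENNReal.toReal_rpow, ← ENNReal.rpow_mul, mul_one_div_cancel hp.ne',
    ENNReal.rpow_one]

/-! ### Scaling, power integrals and the kernel estimate. -/

lemma lintegral_comp_inv_smul {F : EuclideanSpace ℝ (Fin N) → ℝ≥0∞} (hF : Measurable F) {r : ℝ}
    (hr : 0 < r) : ∫⁻ y, F (r⁻¹ • y) = ENNReal.ofReal (r ^ (N : ℝ)) * ∫⁻ y, F y := by
  rw [← lintegral_map (g := fun y => r⁻¹ • y) hF (measurable_const_smul _),
    Measure.map_addHaar_smul _ (inv_ne_zero hr.ne'), lintegral_smul_measure, finrank_euclideanSpace_fin,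
    Real.rpow_natCast, inv_pow, inv_inv, abs_of_pos (by positivity), smul_eq_mul]

lemma integrableOn_ball_norm_rpow (hN : 1 ≤ N) {a : ℝ} (ha : -(N : ℝ) < a) (r : ℝ) :
    IntegrableOn (fun x : EuclideanSpace ℝ (Fin N) => ‖x‖ ^ a) (Metric.ball 0 r) := by
  refine integrableOn_ball_of_norm_le_rpow (C := 1) (α := -a) (by simpa) (by simp; linarith) ?_
    (Measurable.aestronglyMeasurable (by fun_prop))
  refine Eventually.of_forall fun x => ?_
  rw [neg_neg, one_mul, Real.norm_of_nonneg (by positivity)]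

/-- Near the origin only -N < a matters; at infinity the decay is of order N + b - max(a, 0) > N. -/
lemma integrable_one_add_norm_rpow_mul (hN : 1 ≤ N) {a b : ℝ} (ha : -(N : ℝ) < a) (hab : a < b)
    (hb : 0 < b) :
    Integrable (fun z : EuclideanSpace ℝ (Fin N) =>
      (1 + ‖z‖ ^ a) * (1 + ‖z‖) ^ (-((N : ℝ) + b))) := by
  have hm : Measurable (fun z : EuclideanSpace ℝ (Fin N) =>
      (1 + ‖z‖ ^ a) * (1 + ‖z‖) ^ (-((N : ℝ) + b))) := by fun_prop
  rw [← integrableOn_univ, ← Set.union_compl_self (Metric.ball 0 1)]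
  refine IntegrableOn.union ?_ ?_
  · have h1 : IntegrableOn (fun z : EuclideanSpace ℝ (Fin N) => 1 + ‖z‖ ^ a) (Metric.ball 0 1) :=
      (integrableOn_const (by finiteness)).add (integrableOn_ball_norm_rpow hN ha 1)
    refine Integrable.mono' h1 hm.aestronglyMeasurable (Eventually.of_forall fun z => ?_)
    have hz := norm_nonneg z
    rw [Real.norm_of_nonneg (by positivity)]
    refine mul_le_of_le_one_right (by positivity) ?_
    exact Real.rpow_le_one_of_one_le_of_nonpos (by linarith) (by linarith [(Nat.cast_nonneg N : (0:ℝ) ≤ N)])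
  · have h2 : Integrable (fun z : EuclideanSpace ℝ (Fin N) =>
        (1 + ‖z‖) ^ (-((N : ℝ) + b - max a 0))) := by
      refine integrable_one_add_norm ?_
      rw [finrank_euclideanSpace_fin]
      have : max a 0 < b := max_lt hab hb
      linarith
    refine Integrable.mono' (h2.const_mul 2).integrableOn hm.aestronglyMeasurable ?_
    refine (ae_restrict_iff' Metric.isOpen_ball.measurableSet.compl).2 (Eventually.of_forall fun z hz => ?_)
    have hz1 : 1 ≤ ‖z‖ := by simpa using hz
    have hz0 : 0 < 1 + ‖z‖ := by linarith
    rw [Real.norm_of_nonneg (by positivity)]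
    have e : -((N : ℝ) + b - max a 0) = max a 0 + -((N : ℝ) + b) := by ring
    rw [e, Real.rpow_add hz0, ← mul_assoc]
    gcongr
    have h3 : ‖z‖ ^ a ≤ (1 + ‖z‖) ^ max a 0 :=
      (Real.rpow_le_rpow_of_exponent_le hz1 (le_max_left a 0)).trans
        (Real.rpow_le_rpow (by positivity) (by linarith) (le_max_right _ _))
    have h4 : 1 ≤ (1 + ‖z‖) ^ max a 0 := Real.one_le_rpow (by linarith) (le_max_right _ _)
    linarith

/-- A kernel that vanishes linearly at the diagonal and is bounded by `1 + (|y|/|x|)^δ` off it. -/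
def kernel (δ : ℝ) (x y : EuclideanSpace ℝ (Fin N)) : ℝ :=
  if ‖x - y‖ ≤ ‖x‖ / 2 then ‖x - y‖ / ‖x‖ else 1 + (‖y‖ / ‖x‖) ^ δ

lemma kernel_nonneg (δ : ℝ) (x y : EuclideanSpace ℝ (Fin N)) : 0 ≤ kernel δ x y := by
  unfold kernel; split_ifs <;> positivity

lemma measurable_kernel (δ : ℝ) :
    Measurable fun z : EuclideanSpace ℝ (Fin N) × EuclideanSpace ℝ (Fin N) =>
      kernel δ z.1 z.2 := by
  unfold kernel
  refine Measurable.ite (measurableSet_le (by fun_prop) (by fun_prop)) ?_ ?_ <;> fun_prop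

/-- The integral in y is homogeneous in x, of degree -ps, so everything reduces to convergence at
scale |x| = 1. At the diagonal the integrand is |w|^(p-N-ps), integrable as s < 1; off it, δp > -N
serves y near 0 and δ < s serves y near infinity. -/
lemma lintegral_kernel_le (hN : 1 ≤ N) (hs0 : 0 < s) (hs1 : s < 1) (hp : 1 ≤ p) {δ : ℝ}
    (hδ0 : -(N : ℝ) < δ * p) (hδ1 : δ < s) :
    ∃ K : ℝ≥0∞, K ≠ ⊤ ∧ ∀ x : EuclideanSpace ℝ (Fin N), x ≠ 0 →
      ∫⁻ y, ‖kernel δ x y * ‖x - y‖ ^ (-((N : ℝ) / p + s))‖ₑ ^ p ≤ K * ‖‖x‖ ^ (-s)‖ₑ ^ p := by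
  have hp0 : 0 < p := by linarith
  have hps : 0 < p * s := by positivity
  have hNp : (0:ℝ) ≤ N := Nat.cast_nonneg N
  set F₁ : EuclideanSpace ℝ (Fin N) → ℝ :=
    (Metric.ball 0 1).indicator fun w => ‖w‖ ^ (p - ((N : ℝ) + p * s)) with hF₁
  set F₂ : EuclideanSpace ℝ (Fin N) → ℝ :=
    fun z => 2 ^ p * 5 ^ ((N : ℝ) + p * s) * ((1 + ‖z‖ ^ (δ * p)) * (1 + ‖z‖) ^ (-((N : ℝ) + p * s)))
    with hF₂
  have hF₁i : Integrable F₁ := by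
    rw [hF₁, integrable_indicator_iff Metric.isOpen_ball.measurableSet]
    refine integrableOn_ball_norm_rpow hN ?_ 1
    nlinarith
  have hF₂i : Integrable F₂ :=
    (integrable_one_add_norm_rpow_mul hN hδ0 (by nlinarith) hps).const_mul _
  have hF₁m : Measurable F₁ := Measurable.indicator (by fun_prop) Metric.isOpen_ball.measurableSet
  have hF₂m : Measurable F₂ := by fun_prop
  have hF₁0 : ∀ w, 0 ≤ F₁ w := fun w => Set.indicator_nonneg (fun w _ => by positivity) w
  have hF₂0 : ∀ w, 0 ≤ F₂ w := fun w => by positivity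
  refine ⟨(∫⁻ w, ENNReal.ofReal (F₁ w)) + ∫⁻ w, ENNReal.ofReal (F₂ w),
    ENNReal.add_ne_top.2 ⟨hF₁i.lintegral_lt_top.ne, hF₂i.lintegral_lt_top.ne⟩, fun x hx => ?_⟩
  have hr : 0 < ‖x‖ := norm_pos_iff.2 hx
  set r := ‖x‖ with hrdef
  have key : ∀ y, ‖kernel δ x y * ‖x - y‖ ^ (-((N : ℝ) / p + s))‖ₑ ^ p ≤
      ENNReal.ofReal (r ^ (-((N : ℝ) + p * s))) *
        (ENNReal.ofReal (F₁ (r⁻¹ • (x - y))) + ENNReal.ofReal (F₂ (r⁻¹ • y))) := by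
    intro y
    rw [← ENNReal.ofReal_add (hF₁0 _) (hF₂0 _), ← ENNReal.ofReal_mul (by positivity),
      ← ofReal_abs_rpow _ hp0.le]
    refine ENNReal.ofReal_le_ofReal ?_
    have hk := kernel_nonneg δ x y
    rw [abs_of_nonneg (by positivity), Real.mul_rpow hk (by positivity),
      ← Real.rpow_mul (norm_nonneg _)]
    have e2 : -((N : ℝ) / p + s) * p = -((N : ℝ) + p * s) := by field_simp
    rw [e2]
    by_cases hxy : ‖x - y‖ ≤ ‖x‖ / 2
    · have e3 : kernel δ x y = ‖x - y‖ / r := if_pos hxy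
      rcases eq_or_ne x y with rfl | hne
      · rw [e3, sub_self, norm_zero, zero_div, Real.zero_rpow hp0.ne', zero_mul]
        have := hF₁0 (r⁻¹ • 0)
        have := hF₂0 (r⁻¹ • x)
        positivity
      have hd : 0 < ‖x - y‖ := norm_pos_iff.2 (sub_ne_zero.2 hne)
      have e4 : F₁ (r⁻¹ • (x - y)) = (‖x - y‖ / r) ^ (p - ((N : ℝ) + p * s)) := by
        have hn : ‖r⁻¹ • (x - y)‖ = ‖x - y‖ / r := by
          rw [norm_smul, norm_inv, Real.norm_of_nonneg hr.le, inv_mul_eq_div]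
        rw [hF₁, Set.indicator_of_mem, hn]
        rw [mem_ball_zero_iff, hn, div_lt_one hr]
        linarith
      have e5 : (‖x - y‖ / r) ^ p * ‖x - y‖ ^ (-((N : ℝ) + p * s)) =
          r ^ (-((N : ℝ) + p * s)) * (‖x - y‖ / r) ^ (p - ((N : ℝ) + p * s)) := by
        rw [sub_eq_add_neg p, Real.rpow_add (by positivity), Real.div_rpow hd.le hr.le (-((N : ℝ) + p * s))]
        have : r ^ (-((N : ℝ) + p * s)) ≠ 0 := by positivity
        field_simp
      rw [e3, e4, e5]
      gcongr
      linarith [hF₂0 (r⁻¹ • y)]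
    · have e3 : kernel δ x y = 1 + (‖y‖ / r) ^ δ := if_neg hxy
      push Not at hxy
      have hn : ‖r⁻¹ • y‖ = ‖y‖ / r := by
        rw [norm_smul, norm_inv, Real.norm_of_nonneg hr.le, inv_mul_eq_div]
      set t := ‖y‖ / r with ht
      have ht0 : 0 ≤ t := by positivity
      have h1 : (1 + t ^ δ) ^ p ≤ 2 ^ p * (1 + t ^ (δ * p)) := by
        rw [Real.rpow_mul ht0]
        have hq : 0 ≤ t ^ δ := by positivity
        rcases le_total (t ^ δ) 1 with h | h
        · calc (1 + t ^ δ) ^ p ≤ 2 ^ p := by gcongr; linarith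
            _ ≤ _ := le_mul_of_one_le_right (by positivity) (by linarith [Real.rpow_nonneg hq p])
        · calc (1 + t ^ δ) ^ p ≤ (2 * t ^ δ) ^ p := by gcongr; linarith
            _ = 2 ^ p * (t ^ δ) ^ p := Real.mul_rpow (by norm_num) hq
            _ ≤ _ := by gcongr; linarith
      -- Off the diagonal r < 2|x-y|, hence r + |y| ≤ 2r + |x-y| ≤ 5|x-y|.
      have h2 : r * (1 + t) / 5 ≤ ‖x - y‖ := by
        have : r * (1 + t) = r + ‖y‖ := by rw [ht]; field_simp
        rw [this]
        have h3 : ‖y‖ ≤ ‖x‖ + ‖x - y‖ := by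
          have := norm_sub_le x (x - y)
          simpa using this
        linarith
      have h3 : ‖x - y‖ ^ (-((N : ℝ) + p * s)) ≤
          r ^ (-((N : ℝ) + p * s)) * (5 ^ ((N : ℝ) + p * s) * (1 + t) ^ (-((N : ℝ) + p * s))) := by
        refine (Real.rpow_le_rpow_of_nonpos (by positivity) h2 (by linarith)).trans (le_of_eq ?_)
        rw [Real.div_rpow (by positivity) (by norm_num), Real.mul_rpow hr.le (by positivity),
          Real.rpow_neg (by norm_num : (0:ℝ) ≤ 5)]
        field_simp
      rw [e3]
      calc (1 + t ^ δ) ^ p * ‖x - y‖ ^ (-((N : ℝ) + p * s))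
          ≤ (2 ^ p * (1 + t ^ (δ * p))) * (r ^ (-((N : ℝ) + p * s)) *
            (5 ^ ((N : ℝ) + p * s) * (1 + t) ^ (-((N : ℝ) + p * s)))) := by gcongr
        _ = r ^ (-((N : ℝ) + p * s)) * F₂ (r⁻¹ • y) := by rw [hF₂]; simp only [hn]; ring
        _ ≤ _ := by gcongr; linarith [hF₁0 (r⁻¹ • (x - y))]
  refine (lintegral_mono key).trans ?_
  rw [lintegral_const_mul _ (by fun_prop), lintegral_add_left (by fun_prop),
    lintegral_comp_inv_smul (F := fun y => ENNReal.ofReal (F₂ y)) (by fun_prop) hr,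
    lintegral_sub_left_eq_self (fun y => ENNReal.ofReal (F₁ (r⁻¹ • y))) x,
    lintegral_comp_inv_smul (F := fun y => ENNReal.ofReal (F₁ y)) (by fun_prop) hr, ← mul_add,
    ← mul_assoc, ← ENNReal.ofReal_mul (by positivity), ← Real.rpow_add hr, mul_comm,
    ← ofReal_abs_rpow _ hp0.le, abs_of_nonneg (by positivity), ← Real.rpow_mul hr.le]
  refine le_of_eq ?_
  congr 3
  ring

lemma ae_ne_zero (hN : 1 ≤ N) : ∀ᵐ x : EuclideanSpace ℝ (Fin N), x ≠ 0 := by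
  have : Nonempty (Fin N) := ⟨⟨0, hN⟩⟩
  exact Measure.ae_ne volume 0

lemma ae_prod_ne_zero (hN : 1 ≤ N) :
    ∀ᵐ z : EuclideanSpace ℝ (Fin N) × EuclideanSpace ℝ (Fin N), z.1 ≠ 0 ∧ z.2 ≠ 0 := by
  rw [Measure.volume_eq_prod]
  exact (Measure.quasiMeasurePreserving_fst.ae (ae_ne_zero hN)).and
    (Measure.quasiMeasurePreserving_snd.ae (ae_ne_zero hN))

lemma eLpNorm'_kernel_le (hN : 1 ≤ N) (hs0 : 0 < s) (hs1 : s < 1) (hp : 1 ≤ p) {δ : ℝ}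
    (hδ0 : -(N : ℝ) < δ * p) (hδ1 : δ < s) :
    ∃ K : ℝ≥0∞, K ≠ ⊤ ∧ ∀ v : EuclideanSpace ℝ (Fin N) → ℝ, AEStronglyMeasurable v volume →
      eLpNorm' (fun z : EuclideanSpace ℝ (Fin N) × EuclideanSpace ℝ (Fin N) =>
        v z.1 * (kernel δ z.1 z.2 * ‖z.1 - z.2‖ ^ (-((N : ℝ) / p + s)))) p volume ≤
      K * eLpNorm' (hardyFun N s p 0 v) p volume := by
  have hp0 : 0 < p := by linarith
  obtain ⟨K, hK, h⟩ := lintegral_kernel_le (s := s) (p := p) hN hs0 hs1 hp hδ0 hδ1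
  refine ⟨K ^ (1 / p), ENNReal.rpow_ne_top_of_nonneg (by positivity) hK, fun v hv => ?_⟩
  have hm := measurable_kernel (N := N) δ
  have hm2 : AEStronglyMeasurable (fun z : EuclideanSpace ℝ (Fin N) × EuclideanSpace ℝ (Fin N) =>
        v z.1 * (kernel δ z.1 z.2 * ‖z.1 - z.2‖ ^ (-((N : ℝ) / p + s)))) volume := by
    rw [Measure.volume_eq_prod]
    refine hv.comp_fst.mul (Measurable.aestronglyMeasurable ?_)
    exact hm.mul (by fun_prop)
  rw [← ENNReal.rpow_le_rpow_iff hp0, ENNReal.mul_rpow_of_nonneg _ _ hp0.le, ← ENNReal.rpow_mul,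
    one_div_mul_cancel hp0.ne', ENNReal.rpow_one, ← lintegral_rpow_enorm_eq_rpow_eLpNorm' hp0,
    ← lintegral_rpow_enorm_eq_rpow_eLpNorm' hp0, Measure.volume_eq_prod, lintegral_prod, ←
    lintegral_const_mul' _ _ hK]
  · refine lintegral_mono_ae ?_
    filter_upwards [ae_ne_zero hN] with x hx
    simp only [enorm_mul (v x), ENNReal.mul_rpow_of_nonneg _ _ hp0.le]
    rw [lintegral_const_mul' _ _ (ENNReal.rpow_ne_top_of_nonneg hp0.le enorm_ne_top), hardyFun,
      enorm_mul, ENNReal.mul_rpow_of_nonneg _ _ hp0.le, mul_left_comm]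
    gcongr
    simpa using h x hx
  · rw [← Measure.volume_eq_prod]
    exact hm2.enorm.pow_const _

lemma eLpNorm'_swap {f : EuclideanSpace ℝ (Fin N) × EuclideanSpace ℝ (Fin N) → ℝ} :
    eLpNorm' (fun z : EuclideanSpace ℝ (Fin N) × EuclideanSpace ℝ (Fin N) => f z.swap) p volume = eLpNorm' f p volume := by
  rw [eLpNorm', eLpNorm', Measure.volume_eq_prod, lintegral_prod_swap (fun z => ‖f z‖ₑ ^ p)]

/-! ### Weighted versus unweighted difference quotients. -/

/-- Mean value inequality on an interval away from 0. The bound 1 ≤ M lets the same M serve off the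
diagonal in the next lemma. -/
lemma exists_abs_rpow_sub_one_le (δ : ℝ) :
    ∃ M : ℝ, 1 ≤ M ∧ ∀ t ∈ Set.Icc (1 / 2 : ℝ) (3 / 2), |t ^ δ - 1| ≤ M * |t - 1| := by
  have hc : ContinuousOn (fun t : ℝ => δ * t ^ (δ - 1)) (Set.Icc (1 / 2) (3 / 2)) := by
    refine continuousOn_const.mul (ContinuousOn.rpow_const continuousOn_id fun t ht => Or.inl ?_)
    have := ht.1
    exact (lt_of_lt_of_le (by norm_num) ht.1).ne'
  obtain ⟨M, hM⟩ := isCompact_Icc.exists_bound_of_continuousOn hc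
  refine ⟨max M 1, le_max_right _ _, fun t ht => ?_⟩
  have := (convex_Icc (1 / 2 : ℝ) (3 / 2)).norm_image_sub_le_of_norm_hasDerivWithin_le
    (f := fun t : ℝ => t ^ δ) (f' := fun t : ℝ => δ * t ^ (δ - 1)) (C := max M 1) (x := 1) (y := t)
    (fun x hx => (Real.hasDerivAt_rpow_const
      (Or.inl (lt_of_lt_of_le (by norm_num) hx.1).ne')).hasDerivWithinAt)
    (fun x hx => (hM x hx).trans (le_max_left _ _)) (by norm_num) ht
  simpa using this

lemma exists_abs_div_rpow_sub_one_le_kernel (δ : ℝ) :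
    ∃ M : ℝ, 1 ≤ M ∧ ∀ x y : EuclideanSpace ℝ (Fin N), x ≠ 0 →
      |(‖y‖ / ‖x‖) ^ δ - 1| ≤ M * kernel δ x y := by
  obtain ⟨M, hM1, hM⟩ := exists_abs_rpow_sub_one_le δ
  refine ⟨M, hM1, fun x y hx => ?_⟩
  have hr : 0 < ‖x‖ := norm_pos_iff.2 hx
  unfold kernel
  split_ifs with h
  · have h1 : |‖y‖ - ‖x‖| ≤ ‖x - y‖ := by
      rw [norm_sub_rev]; exact abs_norm_sub_norm_le y x
    have h2 : |‖y‖ / ‖x‖ - 1| ≤ ‖x - y‖ / ‖x‖ := by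
      rw [div_sub_one hr.ne', abs_div, abs_of_pos hr]
      gcongr
    have h3 : ‖x - y‖ / ‖x‖ ≤ 1 / 2 := by
      rw [div_le_iff₀ hr]; linarith
    have h4 := abs_le.1 (h2.trans h3)
    exact (hM _ ⟨by linarith, by linarith⟩).trans (by gcongr)
  · have h5 : 0 ≤ (‖y‖ / ‖x‖) ^ δ := by positivity
    calc |(‖y‖ / ‖x‖) ^ δ - 1| ≤ 1 + (‖y‖ / ‖x‖) ^ δ := by
          rw [abs_le]; constructor <;> linarith
      _ ≤ _ := le_mul_of_one_le_left (by positivity) hM1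

/-- The weighted Hardy norm of u is the unweighted one of |x|^α u, so a single quantity mediates
between the two energies. -/
lemma hardyFun_lpFun_ae_eq (hN : 1 ≤ N) (u : EuclideanSpace ℝ (Fin N) → ℝ) :
    hardyFun N s p β u =ᵐ[volume] hardyFun N s p 0 (lpFun N p β u) := by
  filter_upwards [ae_ne_zero hN] with x hx
  have hr : 0 < ‖x‖ := norm_pos_iff.2 hx
  rw [hardyFun, hardyFun, lpFun, mul_assoc, ← Real.rpow_add hr]
  congr 2
  ring

/-- The difference between the weighted difference quotient of `u` and the unweighted one of
`|x|^α u` is controlled by the Hardy norm. -/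
lemma exists_eLpNorm'_gagliardo_sub_le (hN : 1 ≤ N) (hs0 : 0 < s) (hs1 : s < 1) (hp : 1 ≤ p)
    (hβ0 : -(p * s) < β) (hβ1 : β < N) :
    ∃ K : ℝ≥0∞, K ≠ ⊤ ∧ ∀ u : EuclideanSpace ℝ (Fin N) → ℝ, AEStronglyMeasurable u volume →
      eLpNorm' (gagliardo N s p β u - gagliardo N s p 0 (lpFun N p β u)) p volume ≤
        K * eLpNorm' (hardyFun N s p β u) p volume := by
  have hp0 : 0 < p := by linarith
  obtain ⟨K, hK, h⟩ := eLpNorm'_kernel_le (N := N) (s := s) (p := p) (δ := -β / p) hN hs0 hs1 hp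
    (by rw [div_mul_cancel₀ _ hp0.ne']; linarith) (by rw [div_lt_iff₀ hp0]; linarith)
  obtain ⟨M, hM1, hM⟩ := exists_abs_div_rpow_sub_one_le_kernel (N := N) (-β / p)
  refine ⟨2 * (ENNReal.ofReal M * K), by finiteness, fun u hu => ?_⟩
  set δ := -β / p with hδ
  set v := lpFun N p β u with hv
  have hvm : AEStronglyMeasurable v volume := aestronglyMeasurable_lpFun hu
  set W : EuclideanSpace ℝ (Fin N) × EuclideanSpace ℝ (Fin N) → ℝ := fun z =>
    v z.1 * (((‖z.2‖ / ‖z.1‖) ^ δ - 1) * ‖z.1 - z.2‖ ^ (-((N : ℝ) / p + s))) with hW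
  have hWm : AEStronglyMeasurable W volume := by
    rw [Measure.volume_eq_prod]
    exact hvm.comp_fst.mul (Measurable.aestronglyMeasurable (by fun_prop))
  have hWs : AEStronglyMeasurable (fun z : EuclideanSpace ℝ (Fin N) × EuclideanSpace ℝ (Fin N) => W z.swap) volume := by
    rw [Measure.volume_eq_prod] at hWm ⊢
    exact hWm.prod_swap
  have hWle : eLpNorm' W p volume ≤ ENNReal.ofReal M * K * eLpNorm' (hardyFun N s p β u) p volume := by
    rw [eLpNorm'_congr_ae (hardyFun_lpFun_ae_eq hN u), mul_assoc]
    refine le_trans ?_ (mul_le_mul_right (h v hvm) _)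
    refine eLpNorm'_le_mul_eLpNorm'_of_ae_le_mul ?_ ?_ hp0
    · rw [Measure.volume_eq_prod]
      exact hvm.comp_fst.mul (Measurable.aestronglyMeasurable
        ((measurable_kernel δ).mul (by fun_prop)))
    · filter_upwards [ae_prod_ne_zero hN] with z hz
      have hk := kernel_nonneg δ z.1 z.2
      rw [hW, Real.enorm_eq_ofReal_abs, Real.enorm_eq_ofReal_abs, ← ENNReal.ofReal_mul (by linarith)]
      refine ENNReal.ofReal_le_ofReal ?_
      simp only [abs_mul, abs_of_nonneg hk]
      refine (mul_le_mul_of_nonneg_left (mul_le_mul_of_nonneg_right (hM z.1 z.2 hz.1)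
        (abs_nonneg _)) (abs_nonneg _)).trans (le_of_eq (by ring))
  -- Since v = |x|^(2δ) u, one has u(x)|x|^δ|y|^δ = v(x)(|y|/|x|)^δ, and symmetrically for y. The
  -- two halves are exchanged by the swap, so their norms agree; hence the factor 2 in the constant.
  have heq : gagliardo N s p β u - gagliardo N s p 0 v =ᵐ[volume] W + -(fun z : EuclideanSpace ℝ (Fin N) × EuclideanSpace ℝ (Fin N) => W z.swap) := by
    filter_upwards [ae_prod_ne_zero hN] with z hz
    have h1 : 0 < ‖z.1‖ := norm_pos_iff.2 hz.1
    have h2 : 0 < ‖z.2‖ := norm_pos_iff.2 hz.2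
    simp only [Pi.sub_apply, Pi.add_apply, Pi.neg_apply, hW, gagliardo, hv, lpFun, Prod.fst_swap,
      Prod.snd_swap, neg_zero, zero_div, Real.rpow_zero, one_mul]
    rw [norm_sub_rev z.2 z.1, Real.div_rpow h2.le h1.le, Real.div_rpow h1.le h2.le, ← hδ]
    have e : -2 * β / p = δ + δ := by rw [hδ]; ring
    rw [e, Real.rpow_add h1, Real.rpow_add h2]
    have h3 : ‖z.1‖ ^ δ ≠ 0 := by positivity
    have h4 : ‖z.2‖ ^ δ ≠ 0 := by positivity
    field_simp
    ring
  rw [eLpNorm'_congr_ae heq]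
  refine (eLpNorm'_add_le hWm hWs.neg hp).trans ?_
  rw [eLpNorm'_neg, eLpNorm'_swap, ← two_mul, mul_assoc]
  gcongr

lemma eLpNorm'_le_add_sub {α : Type*} [MeasurableSpace α] {μ : Measure α} {f g : α → ℝ} (hp : 1 ≤ p)
    (hf : AEStronglyMeasurable f μ) (hg : AEStronglyMeasurable g μ) :
    eLpNorm' f p μ ≤ eLpNorm' g p μ + eLpNorm' (f - g) p μ := by
  simpa using eLpNorm'_add_le hg (hf.sub hg) hp

lemma eLpNorm'_sub_comm {α : Type*} [MeasurableSpace α] {μ : Measure α} (f g : α → ℝ) :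
    eLpNorm' (f - g) p μ = eLpNorm' (g - f) p μ := by
  rw [← neg_sub, eLpNorm'_neg]

/-! ### The weighted fractional Hardy inequality by comparison on shells. -/

/-- The pairs `(x, y)` for which `|y|` lies between `a |x|` and `2 a |x|`. -/
def shell (N : ℕ) (a : ℝ) : Set (EuclideanSpace ℝ (Fin N) × EuclideanSpace ℝ (Fin N)) :=
  {z | a * ‖z.1‖ < ‖z.2‖ ∧ ‖z.2‖ ≤ 2 * a * ‖z.1‖}

lemma measurableSet_shell (a : ℝ) : MeasurableSet (shell N a) :=
  have h₁ : MeasurableSet {z : EuclideanSpace ℝ (Fin N) × EuclideanSpace ℝ (Fin N) |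
      a * ‖z.1‖ < ‖z.2‖} := measurableSet_lt (by fun_prop) (by fun_prop)
  have h₂ : MeasurableSet {z : EuclideanSpace ℝ (Fin N) × EuclideanSpace ℝ (Fin N) |
      ‖z.2‖ ≤ 2 * a * ‖z.1‖} := measurableSet_le (by fun_prop) (by fun_prop)
  h₁.inter h₂

/-- For fixed x the shell is an annulus in y of measure a^N |x|^N times that of the unit one, and
the power of |x| cancels |x|^N. -/
lemma eLpNorm'_shell_fst (hN : 1 ≤ N) (hp : 0 < p) {a : ℝ} (ha : 0 < a)
    {h : EuclideanSpace ℝ (Fin N) → ℝ} (hh : AEStronglyMeasurable h volume) :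
    eLpNorm' ((shell N a).indicator fun z => h z.1 * ‖z.1‖ ^ (-(N : ℝ) / p)) p volume =
      (ENNReal.ofReal (a ^ (N : ℝ)) *
        volume {w : EuclideanSpace ℝ (Fin N) | 1 < ‖w‖ ∧ ‖w‖ ≤ 2}) ^ (1 / p) *
        eLpNorm' h p volume := by
  set A := {w : EuclideanSpace ℝ (Fin N) | 1 < ‖w‖ ∧ ‖w‖ ≤ 2} with hA
  have h₁ : MeasurableSet {w : EuclideanSpace ℝ (Fin N) | 1 < ‖w‖} :=
    measurableSet_lt (by fun_prop) (by fun_prop)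
  have h₂ : MeasurableSet {w : EuclideanSpace ℝ (Fin N) | ‖w‖ ≤ 2} :=
    measurableSet_le (by fun_prop) (by fun_prop)
  have hAm : MeasurableSet A := h₁.inter h₂
  rw [eLpNorm', eLpNorm', ← ENNReal.mul_rpow_of_nonneg _ _ (by positivity)]
  congr 1
  rw [Measure.volume_eq_prod, lintegral_prod]
  · rw [← lintegral_const_mul'' _ (hh.enorm.pow_const p)]
    refine lintegral_congr_ae ?_
    filter_upwards [ae_ne_zero hN] with x hx
    have hr : 0 < ‖x‖ := norm_pos_iff.2 hx
    have key : ∀ y, ‖(shell N a).indicator (fun z => h z.1 * ‖z.1‖ ^ (-(N : ℝ) / p)) (x, y)‖ₑ ^ p =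
        ‖h x‖ₑ ^ p * ENNReal.ofReal (‖x‖ ^ (-(N : ℝ))) *
          A.indicator (fun _ => 1) ((a * ‖x‖)⁻¹ • y) := by
      intro y
      have hmem : (a * ‖x‖)⁻¹ • y ∈ A ↔ (x, y) ∈ shell N a := by
        simp only [hA, shell, Set.mem_ofPred_eq, norm_smul, norm_inv,
          Real.norm_of_nonneg (by positivity : 0 ≤ a * ‖x‖)]
        rw [inv_mul_eq_div, lt_div_iff₀ (by positivity), div_le_iff₀ (by positivity), one_mul,
          mul_assoc 2]
      by_cases hm : (x, y) ∈ shell N a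
      · rw [Set.indicator_of_mem hm, Set.indicator_of_mem (hmem.2 hm), mul_one, enorm_mul,
          ENNReal.mul_rpow_of_nonneg _ _ hp.le, ← ofReal_abs_rpow (‖x‖ ^ (-(N : ℝ) / p)) hp.le,
          abs_of_nonneg (by positivity), ← Real.rpow_mul (norm_nonneg _), div_mul_cancel₀ _ hp.ne']
      · rw [Set.indicator_of_notMem hm, Set.indicator_of_notMem (fun h => hm (hmem.1 h)), mul_zero,
          enorm_zero, ENNReal.zero_rpow_of_pos hp]
    simp only [key]
    rw [lintegral_const_mul' _ _ (by finiteness), lintegral_comp_inv_smul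
      (F := A.indicator fun _ => 1) (measurable_const.indicator hAm) (by positivity),
      lintegral_indicator hAm, setLIntegral_one, mul_assoc, ← mul_assoc (ENNReal.ofReal _),
      ← ENNReal.ofReal_mul (by positivity), Real.mul_rpow ha.le hr.le, mul_left_comm (‖x‖ ^ _),
      ← Real.rpow_add hr, neg_add_cancel, Real.rpow_zero, mul_one, mul_comm]
  · refine AEMeasurable.pow_const (AEStronglyMeasurable.enorm ?_) _
    refine AEStronglyMeasurable.indicator ?_ (measurableSet_shell a)
    exact hh.comp_fst.mul (Measurable.aestronglyMeasurable (by fun_prop))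

/-- Here y is fixed and x runs over |y|/(2a) ≤ |x| < |y|/a. Rescaling x by |y|/a leaves a^(γp+N)
a^(-N) = a^(γp), to be compared with a^N in `eLpNorm'_shell_fst`. -/
lemma eLpNorm'_shell_snd (hN : 1 ≤ N) (hp : 0 < p) {a : ℝ} (ha : 0 < a) (γ : ℝ)
    {h : EuclideanSpace ℝ (Fin N) → ℝ} (hh : AEStronglyMeasurable h volume) :
    eLpNorm' ((shell N a).indicator fun z => h z.2 * (‖z.2‖ ^ γ * ‖z.1‖ ^ (-γ - (N : ℝ) / p))) p
        volume =
      (ENNReal.ofReal (a ^ (γ * p)) *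
        ∫⁻ w in {w : EuclideanSpace ℝ (Fin N) | 1 / 2 ≤ ‖w‖ ∧ ‖w‖ < 1},
          ENNReal.ofReal (‖w‖ ^ (-(γ * p + N)))) ^ (1 / p) *
        eLpNorm' h p volume := by
  set A := {w : EuclideanSpace ℝ (Fin N) | 1 / 2 ≤ ‖w‖ ∧ ‖w‖ < 1} with hA
  have h₁ : MeasurableSet {w : EuclideanSpace ℝ (Fin N) | 1 / 2 ≤ ‖w‖} :=
    measurableSet_le (by fun_prop) (by fun_prop)
  have h₂ : MeasurableSet {w : EuclideanSpace ℝ (Fin N) | ‖w‖ < 1} :=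
    measurableSet_lt (by fun_prop) (by fun_prop)
  have hAm : MeasurableSet A := h₁.inter h₂
  rw [eLpNorm', eLpNorm', ← ENNReal.mul_rpow_of_nonneg _ _ (by positivity)]
  congr 1
  rw [Measure.volume_eq_prod, lintegral_prod_symm]
  · rw [← lintegral_const_mul'' _ (hh.enorm.pow_const p)]
    refine lintegral_congr_ae ?_
    filter_upwards [ae_ne_zero hN] with y hy
    have hr : 0 < ‖y‖ := norm_pos_iff.2 hy
    have key : ∀ x, ‖(shell N a).indicator
          (fun z => h z.2 * (‖z.2‖ ^ γ * ‖z.1‖ ^ (-γ - (N : ℝ) / p))) (x, y)‖ₑ ^ p =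
        ‖h y‖ₑ ^ p * ENNReal.ofReal (a ^ (γ * p + N) * ‖y‖ ^ (-(N : ℝ))) *
          A.indicator (fun w => ENNReal.ofReal (‖w‖ ^ (-(γ * p + N)))) ((‖y‖ / a)⁻¹ • x) := by
      intro x
      have hn : ‖(‖y‖ / a)⁻¹ • x‖ = a * ‖x‖ / ‖y‖ := by
        rw [norm_smul, norm_inv, Real.norm_of_nonneg (by positivity : 0 ≤ ‖y‖ / a)]
        field_simp
      have hmem : (‖y‖ / a)⁻¹ • x ∈ A ↔ (x, y) ∈ shell N a := by
        simp only [hA, shell, Set.mem_ofPred_eq, hn]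
        rw [le_div_iff₀ hr, div_lt_one hr, and_comm]
        refine and_congr Iff.rfl ?_
        constructor <;> intro h <;> linarith
      by_cases hm : (x, y) ∈ shell N a
      · have hx : 0 < ‖x‖ := by
          have := hm.2
          by_contra hx
          have : ‖x‖ = 0 := le_antisymm (not_lt.1 hx) (norm_nonneg _)
          simp_all
        rw [Set.indicator_of_mem hm, Set.indicator_of_mem (hmem.2 hm), enorm_mul,
          ENNReal.mul_rpow_of_nonneg _ _ hp.le, ← ofReal_abs_rpow (‖y‖ ^ γ * ‖x‖ ^ (-γ - (N : ℝ) / p)) hp.le,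
          abs_of_nonneg (by positivity), mul_assoc, ← ENNReal.ofReal_mul (by positivity), hn]
        congr 2
        rw [Real.mul_rpow (by positivity) (by positivity), ← Real.rpow_mul (norm_nonneg _),
          ← Real.rpow_mul (norm_nonneg _), Real.div_rpow (by positivity) (by positivity),
          Real.mul_rpow (by positivity) (by positivity), Real.rpow_neg ha.le,
          Real.rpow_neg hr.le (γ * p + N), Real.rpow_add hr, Real.rpow_neg hr.le (N : ℝ)]
        have e : (-γ - (N : ℝ) / p) * p = -(γ * p + N) := by field_simp; ring
        rw [e]
        have : a ^ (γ * p + (N : ℝ)) ≠ 0 := by positivity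
        field_simp
      · rw [Set.indicator_of_notMem hm, Set.indicator_of_notMem (fun h => hm (hmem.1 h)), mul_zero,
          enorm_zero, ENNReal.zero_rpow_of_pos hp]
    simp only [key]
    rw [lintegral_const_mul' _ _ (by finiteness), lintegral_comp_inv_smul
      (F := A.indicator (fun w => ENNReal.ofReal (‖w‖ ^ (-(γ * p + N)))))
      (Measurable.indicator (by fun_prop) hAm) (by positivity),
      lintegral_indicator hAm, mul_assoc, ← mul_assoc (ENNReal.ofReal _),
      ← ENNReal.ofReal_mul (by positivity), mul_comm]
    congr 3
    rw [Real.div_rpow hr.le ha.le, Real.rpow_add ha, Real.rpow_neg hr.le]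
    field_simp
  · refine AEMeasurable.pow_const (AEStronglyMeasurable.enorm ?_) _
    refine AEStronglyMeasurable.indicator ?_ (measurableSet_shell a)
    exact hh.comp_snd.mul (Measurable.aestronglyMeasurable (by fun_prop))

/-- On the shell |y| and |x-y| are comparable to |x|, and both sides have the same homogeneity, 2δ -
N/p - s with δ = -β/p. Having a ≥ 1 keeps y away from x. -/
lemma rpow_shell_le (hp : 0 < p) (hs : 0 < s) {a : ℝ} (ha : 1 ≤ a) :
    ∃ C : ℝ, 0 ≤ C ∧ ∀ x y : EuclideanSpace ℝ (Fin N), x ≠ 0 → (x, y) ∈ shell N a →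
      ‖x‖ ^ (-(s + 2 * β / p) - (N : ℝ) / p) ≤
        C * (‖x‖ ^ (-β / p) * ‖y‖ ^ (-β / p) * ‖x - y‖ ^ (-((N : ℝ) / p + s))) := by
  set δ := -β / p with hδ
  have ha0 : 0 < a := by linarith
  have hNp : 0 ≤ (N : ℝ) / p := by positivity
  -- The minimum covers both signs of δ: |y|^δ is bounded below by the inner radius if δ ≥ 0 and by
  -- the outer one if δ ≤ 0.
  set c := min (a ^ δ) ((2 * a) ^ δ) * (1 + 2 * a) ^ (-((N : ℝ) / p + s)) with hc
  have hc0 : 0 < c := mul_pos (lt_min (by positivity) (by positivity)) (by positivity)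
  refine ⟨c⁻¹, by positivity, fun x y hx hm => ?_⟩
  have hr : 0 < ‖x‖ := norm_pos_iff.2 hx
  obtain ⟨h1, h2⟩ := hm
  simp only at h1 h2
  have hy : 0 < ‖y‖ := lt_of_le_of_lt (by positivity) h1
  have hxy : 0 < ‖x - y‖ := by
    rw [norm_pos_iff, sub_ne_zero]
    rintro rfl
    nlinarith
  have h3 : ‖x - y‖ ≤ (1 + 2 * a) * ‖x‖ := (norm_sub_le x y).trans (by linarith)
  have h4 : ((1 + 2 * a) * ‖x‖) ^ (-((N : ℝ) / p + s)) ≤ ‖x - y‖ ^ (-((N : ℝ) / p + s)) :=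
    Real.rpow_le_rpow_of_nonpos hxy h3 (by linarith)
  have h5 : min (a ^ δ) ((2 * a) ^ δ) * ‖x‖ ^ δ ≤ ‖y‖ ^ δ := by
    rcases le_total 0 δ with h | h
    · calc _ ≤ a ^ δ * ‖x‖ ^ δ := by gcongr; exact min_le_left _ _
        _ = (a * ‖x‖) ^ δ := (Real.mul_rpow ha0.le hr.le).symm
        _ ≤ _ := Real.rpow_le_rpow (by positivity) h1.le h
    · calc _ ≤ (2 * a) ^ δ * ‖x‖ ^ δ := by gcongr; exact min_le_right _ _
        _ = (2 * a * ‖x‖) ^ δ := (Real.mul_rpow (by positivity) hr.le).symm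
        _ ≤ _ := Real.rpow_le_rpow_of_nonpos hy h2 h
  rw [← div_eq_inv_mul, le_div_iff₀ hc0]
  calc ‖x‖ ^ (-(s + 2 * β / p) - (N : ℝ) / p) * c
      = ‖x‖ ^ δ * (min (a ^ δ) ((2 * a) ^ δ) * ‖x‖ ^ δ) *
        ((1 + 2 * a) * ‖x‖) ^ (-((N : ℝ) / p + s)) := by
        rw [Real.mul_rpow (by positivity) hr.le, hc]
        have e : -(s + 2 * β / p) - (N : ℝ) / p = δ + δ + -((N : ℝ) / p + s) := by rw [hδ]; ring
        rw [e, Real.rpow_add hr, Real.rpow_add hr]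
        ring
    _ ≤ _ := by gcongr

/-- As γp < N, a^(γp) is negligible against a^N for large a; the factor 2 makes absorption possible.
-/
lemma exists_shell_ratio (hN : 1 ≤ N) (hp : 0 < p) {γ : ℝ} (hγ : γ * p < N) :
    ∃ a : ℝ, 1 ≤ a ∧
      2 * (ENNReal.ofReal (a ^ (γ * p)) *
        ∫⁻ w in {w : EuclideanSpace ℝ (Fin N) | 1 / 2 ≤ ‖w‖ ∧ ‖w‖ < 1},
          ENNReal.ofReal (‖w‖ ^ (-(γ * p + N)))) ^ (1 / p) ≤
      (ENNReal.ofReal (a ^ (N : ℝ)) *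
        volume {w : EuclideanSpace ℝ (Fin N) | 1 < ‖w‖ ∧ ‖w‖ ≤ 2}) ^ (1 / p) ∧
      (ENNReal.ofReal (a ^ (N : ℝ)) *
        volume {w : EuclideanSpace ℝ (Fin N) | 1 < ‖w‖ ∧ ‖w‖ ≤ 2}) ^ (1 / p) ≠ 0 ∧
      (ENNReal.ofReal (a ^ (N : ℝ)) *
        volume {w : EuclideanSpace ℝ (Fin N) | 1 < ‖w‖ ∧ ‖w‖ ≤ 2}) ^ (1 / p) ≠ ⊤ := by
  set m' := ∫⁻ w in {w : EuclideanSpace ℝ (Fin N) | 1 / 2 ≤ ‖w‖ ∧ ‖w‖ < 1},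
          ENNReal.ofReal (‖w‖ ^ (-(γ * p + N))) with hm'
  set m := volume {w : EuclideanSpace ℝ (Fin N) | 1 < ‖w‖ ∧ ‖w‖ ≤ 2} with hm
  have hm'top : m' ≠ ⊤ := by
    have hcomp : IsCompact {w : EuclideanSpace ℝ (Fin N) | 1 / 2 ≤ ‖w‖ ∧ ‖w‖ ≤ 1} := by
      refine (isCompact_closedBall (0 : EuclideanSpace ℝ (Fin N)) 1).of_isClosed_subset ?_ ?_
      · exact (isClosed_le continuous_const continuous_norm).inter
          (isClosed_le continuous_norm continuous_const)
      · intro w hw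
        simpa using hw.2
    have hint : IntegrableOn (fun w : EuclideanSpace ℝ (Fin N) => ‖w‖ ^ (-(γ * p + N)))
        {w : EuclideanSpace ℝ (Fin N) | 1 / 2 ≤ ‖w‖ ∧ ‖w‖ ≤ 1} := by
      refine ContinuousOn.integrableOn_compact hcomp ?_
      refine ContinuousOn.rpow_const continuous_norm.continuousOn fun w hw => Or.inl ?_
      exact (lt_of_lt_of_le (by norm_num) hw.1).ne'
    refine ne_top_of_le_ne_top hint.lintegral_lt_top.ne ?_
    exact lintegral_mono_set fun w hw => ⟨hw.1, hw.2.le⟩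
  have hmtop : m ≠ ⊤ := by
    refine ne_top_of_le_ne_top (measure_closedBall_lt_top (x := (0 : EuclideanSpace ℝ (Fin N)))
      (r := 2)).ne (measure_mono fun w hw => ?_)
    simpa using hw.2
  have hm0 : m ≠ 0 := by
    have : Nonempty (Fin N) := ⟨⟨0, hN⟩⟩
    obtain ⟨w, hw⟩ := NormedSpace.exists_lt_norm ℝ (EuclideanSpace ℝ (Fin N)) 0
    have ho : IsOpen {w : EuclideanSpace ℝ (Fin N) | 1 < ‖w‖ ∧ ‖w‖ < 2} :=
      (isOpen_lt continuous_const continuous_norm).inter (isOpen_lt continuous_norm continuous_const)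
    have hne : {w : EuclideanSpace ℝ (Fin N) | 1 < ‖w‖ ∧ ‖w‖ < 2}.Nonempty := by
      refine ⟨((3 / 2) * ‖w‖⁻¹) • w, ?_⟩
      have : ‖((3 / 2) * ‖w‖⁻¹) • w‖ = 3 / 2 := by
        rw [norm_smul, norm_mul, norm_inv, norm_norm, mul_assoc, inv_mul_cancel₀ hw.ne', mul_one]
        norm_num
      rw [Set.mem_ofPred_eq, this]
      norm_num
    have hsub : {w : EuclideanSpace ℝ (Fin N) | 1 < ‖w‖ ∧ ‖w‖ < 2} ⊆
        {w : EuclideanSpace ℝ (Fin N) | 1 < ‖w‖ ∧ ‖w‖ ≤ 2} := fun w hw => ⟨hw.1, hw.2.le⟩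
    exact ((ho.measure_pos volume hne).trans_le (measure_mono hsub)).ne'
  have hev : ∀ᶠ a : ℝ in atTop, 2 ^ p * m'.toReal / m.toReal ≤ a ^ ((N : ℝ) - γ * p) :=
    (tendsto_rpow_atTop (by linarith)).eventually_ge_atTop _
  obtain ⟨a, hle, ha⟩ := (hev.and (eventually_ge_atTop 1)).exists
  have ha0 : 0 < a := by linarith
  have hmpos : 0 < m.toReal := ENNReal.toReal_pos hm0 hmtop
  refine ⟨a, ha, ?_, ?_, ?_⟩
  · rw [← ENNReal.rpow_le_rpow_iff hp, ENNReal.mul_rpow_of_nonneg _ _ hp.le, ← ENNReal.rpow_mul,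
      ← ENNReal.rpow_mul, one_div_mul_cancel hp.ne', ENNReal.rpow_one, ENNReal.rpow_one]
    rw [← ENNReal.ofReal_toReal hm'top, ← ENNReal.ofReal_toReal hmtop,
      ← ENNReal.ofReal_mul (by positivity), ← ENNReal.ofReal_mul (by positivity)]
    have e2 : (2 : ℝ≥0∞) ^ p = ENNReal.ofReal (2 ^ p) := by
      rw [← ENNReal.ofReal_rpow_of_pos (by norm_num), ENNReal.ofReal_ofNat]
    rw [e2, ← ENNReal.ofReal_mul (by positivity)]
    refine ENNReal.ofReal_le_ofReal ?_
    rw [div_le_iff₀ hmpos, Real.rpow_sub ha0, div_mul_eq_mul_div, le_div_iff₀ (by positivity)] at hle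
    linarith
  · refine (ENNReal.rpow_pos (pos_iff_ne_zero.2 (mul_ne_zero ?_ hm0)) (by finiteness)).ne'
    simpa using by positivity
  · exact ENNReal.rpow_ne_top_of_nonneg (by positivity) (by finiteness)

/-- The weighted fractional Hardy inequality, for functions with finite weighted `L^p` norm. -/
lemma exists_hardy_of_lpFun (hN : 1 ≤ N) (hs0 : 0 < s) (hp : 1 ≤ p)
    (hβ1 : β < ((N : ℝ) - p * s) / 2) :
    ∃ K : ℝ≥0∞, K ≠ ⊤ ∧ ∀ u : EuclideanSpace ℝ (Fin N) → ℝ, AEStronglyMeasurable u volume →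
      eLpNorm' (lpFun N p β u) p volume ≠ ⊤ →
      eLpNorm' (hardyFun N s p β u) p volume ≤ K * eLpNorm' (gagliardo N s p β u) p volume := by
  have hp0 : 0 < p := by linarith
  set γ := s + 2 * β / p with hγ
  -- This is exactly the condition β < (N-ps)/2.
  have hγp : γ * p < N := by
    have : γ * p = s * p + 2 * β := by rw [hγ]; field_simp
    linarith
  obtain ⟨a, ha, h2, hm0, hmtop⟩ := exists_shell_ratio hN hp0 hγp
  obtain ⟨C, hC0, hC⟩ := rpow_shell_le (N := N) (s := s) (p := p) (β := β) hp0 hs0 ha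
  have ha0 : 0 < a := by linarith
  set M₁ := (ENNReal.ofReal (a ^ (N : ℝ)) *
        volume {w : EuclideanSpace ℝ (Fin N) | 1 < ‖w‖ ∧ ‖w‖ ≤ 2}) ^ (1 / p) with hM₁
  set M₂ := (ENNReal.ofReal (a ^ (γ * p)) *
        ∫⁻ w in {w : EuclideanSpace ℝ (Fin N) | 1 / 2 ≤ ‖w‖ ∧ ‖w‖ < 1},
          ENNReal.ofReal (‖w‖ ^ (-(γ * p + N)))) ^ (1 / p) with hM₂
  refine ⟨M₁⁻¹ * (2 * ENNReal.ofReal C), by finiteness, fun u hu hfin => ?_⟩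
  have hhm : AEStronglyMeasurable (hardyFun N s p β u) volume := aestronglyMeasurable_hardyFun hu
  have hgm : AEStronglyMeasurable (gagliardo N s p β u) volume := aestronglyMeasurable_gagliardo hu
  set T : ℝ → Set (EuclideanSpace ℝ (Fin N)) := fun ε => {x | ε < ‖x‖} with hT
  have hTm : ∀ ε, MeasurableSet (T ε) := fun ε => measurableSet_lt (by fun_prop) (by fun_prop)
  have main : ∀ ε : ℝ, 0 < ε → eLpNorm' ((T ε).indicator (hardyFun N s p β u)) p volume ≤
      M₁⁻¹ * (2 * ENNReal.ofReal C) * eLpNorm' (gagliardo N s p β u) p volume := by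
    intro ε hε
    set h := (T ε).indicator (hardyFun N s p β u) with hh
    have hm : AEStronglyMeasurable h volume := hhm.indicator (hTm ε)
    -- Absorption needs a finite norm. Outside the ball of radius ε the Hardy weight is at most
    -- ε^(-s) times the L^p weight; this is the only use of the L^p hypothesis.
    have hX : eLpNorm' h p volume ≠ ⊤ := by
      refine ne_top_of_le_ne_top (ENNReal.mul_ne_top (ENNReal.ofReal_ne_top (r := ε ^ (-s))) hfin)
        (eLpNorm'_le_mul_eLpNorm'_of_ae_le_mul (aestronglyMeasurable_lpFun hu)
          (Eventually.of_forall fun x => ?_) hp0)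
      by_cases hx : x ∈ T ε
      · have hx' : ε < ‖x‖ := hx
        have hr : 0 < ‖x‖ := by linarith
        rw [hh, Set.indicator_of_mem hx, Real.enorm_eq_ofReal_abs, Real.enorm_eq_ofReal_abs,
          ← ENNReal.ofReal_mul (by positivity)]
        refine ENNReal.ofReal_le_ofReal ?_
        have e : -(s + 2 * β / p) = -s + -2 * β / p := by ring
        rw [hardyFun, lpFun, e, Real.rpow_add hr, mul_left_comm, abs_mul,
          abs_of_nonneg (by positivity : 0 ≤ ‖x‖ ^ (-s))]
        gcongr ?_ * _
        exact Real.rpow_le_rpow_of_nonpos hε hx'.le (by linarith)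
      · rw [hh, Set.indicator_of_notMem hx, enorm_zero]
        exact zero_le
    set g := (shell N a).indicator
      fun z => h z.2 * (‖z.2‖ ^ γ * ‖z.1‖ ^ (-γ - (N : ℝ) / p)) with hg
    have hgm' : AEStronglyMeasurable g volume := by
      refine AEStronglyMeasurable.indicator ?_ (measurableSet_shell a)
      rw [Measure.volume_eq_prod]
      exact hm.comp_snd.mul (Measurable.aestronglyMeasurable (by fun_prop))
    have step : M₁ * eLpNorm' h p volume ≤
        ENNReal.ofReal C * eLpNorm' (gagliardo N s p β u) p volume + M₂ * eLpNorm' h p volume := by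
      rw [hM₁, hM₂, ← eLpNorm'_shell_fst hN hp0 ha0 hm, ← eLpNorm'_shell_snd hN hp0 ha0 γ hm]
      have e1 : ENNReal.ofReal C * eLpNorm' (gagliardo N s p β u) p volume =
          eLpNorm' (fun z => |(C • gagliardo N s p β u) z|) p volume := by
        rw [← Real.enorm_eq_ofReal hC0, ← eLpNorm'_const_smul _ hp0]
        exact (eLpNorm'_norm (f := C • gagliardo N s p β u)).symm
      have e2 : eLpNorm' ((shell N a).indicator
          fun z => h z.2 * (‖z.2‖ ^ γ * ‖z.1‖ ^ (-γ - (N : ℝ) / p))) p volume =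
          eLpNorm' (fun z => |g z|) p volume := (eLpNorm'_norm (f := g)).symm
      rw [e1, e2]
      refine le_trans ?_ (eLpNorm'_add_le (hgm.const_smul C).norm hgm'.norm hp)
      refine eLpNorm'_mono_ae hp0.le (Eventually.of_forall fun z => ?_)
      rw [Pi.add_apply, Real.norm_of_nonneg (add_nonneg (abs_nonneg _) (abs_nonneg _))]
      by_cases hz : z ∈ shell N a
      swap
      · rw [Set.indicator_of_notMem hz, norm_zero]; positivity
      by_cases hz1 : z.1 ∈ T ε
      swap
      · rw [Set.indicator_of_mem hz, hh, Set.indicator_of_notMem hz1, zero_mul, norm_zero]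
        positivity
      have hz1' : ε < ‖z.1‖ := hz1
      have hr : 0 < ‖z.1‖ := by linarith
      have hz12 : a * ‖z.1‖ < ‖z.2‖ := hz.1
      -- The shell points outwards because a ≥ 1, so the truncation at x does not remove the
      -- companion y.
      have hz2' : ε < ‖z.2‖ := by nlinarith
      have hr2 : 0 < ‖z.2‖ := by linarith
      have hz2 : z.2 ∈ T ε := hz2'
      have hCz := hC z.1 z.2 (norm_pos_iff.1 hr) hz
      rw [Set.indicator_of_mem hz, hg, Set.indicator_of_mem hz, hh, Set.indicator_of_mem hz1,
        Set.indicator_of_mem hz2, hardyFun, hardyFun, ← hγ, Real.norm_eq_abs, mul_assoc (u z.1),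
        ← Real.rpow_add hr, mul_assoc (u z.2), ← mul_assoc (‖z.2‖ ^ _), ← Real.rpow_add hr2,
        neg_add_cancel, Real.rpow_zero, one_mul, Pi.smul_apply, smul_eq_mul]
      have e3 : -γ + -(N : ℝ) / p = -γ - (N : ℝ) / p := by ring
      rw [e3]
      set W := ‖z.1‖ ^ (-γ - (N : ℝ) / p) with hW
      have hW0 : 0 ≤ W := by positivity
      set V := ‖z.1‖ ^ (-β / p) * ‖z.2‖ ^ (-β / p) * ‖z.1 - z.2‖ ^ (-((N : ℝ) / p + s)) with hV
      have hV0 : 0 ≤ V := by positivity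
      calc |u z.1 * W| = |(u z.1 - u z.2) * W + u z.2 * W| := by ring_nf
        _ ≤ |u z.1 - u z.2| * W + |u z.2 * W| := by
            refine (abs_add_le _ _).trans ?_
            rw [abs_mul, abs_of_nonneg hW0]
        _ ≤ |u z.1 - u z.2| * (C * V) + |u z.2 * W| := by gcongr
        _ = _ := by
            rw [gagliardo, ← hV, abs_mul C, abs_mul _ V, abs_of_nonneg hC0, abs_of_nonneg hV0]
            ring
    -- Double `step`, use 2 M₂ ≤ M₁ and cancel one finite copy of M₁‖h‖.
    have hdouble : M₁ * eLpNorm' h p volume ≤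
        2 * ENNReal.ofReal C * eLpNorm' (gagliardo N s p β u) p volume := by
      have hne : M₁ * eLpNorm' h p volume ≠ ⊤ := by finiteness
      refine (ENNReal.add_le_add_iff_right hne).1 ?_
      calc M₁ * eLpNorm' h p volume + M₁ * eLpNorm' h p volume
          = 2 * (M₁ * eLpNorm' h p volume) := (two_mul _).symm
        _ ≤ 2 * (ENNReal.ofReal C * eLpNorm' (gagliardo N s p β u) p volume +
            M₂ * eLpNorm' h p volume) := by gcongr
        _ = 2 * ENNReal.ofReal C * eLpNorm' (gagliardo N s p β u) p volume +
            2 * M₂ * eLpNorm' h p volume := by ring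
        _ ≤ _ := by gcongr
    rw [mul_assoc, ← ENNReal.mul_le_iff_le_inv hm0 hmtop]
    exact hdouble
  -- The constant does not depend on ε, so Fatou's lemma removes the truncation.
  have hlim := Lp.eLpNorm'_lim_le_liminf_eLpNorm' (μ := volume) (p := p) hp0
    (f := fun n : ℕ => (T (1 / ((n : ℝ) + 1))).indicator (hardyFun N s p β u))
    (fun n => hhm.indicator (hTm _)) (f_lim := hardyFun N s p β u) ?_
  · refine hlim.trans (liminf_le_of_frequently_le' (Frequently.of_forall fun n => ?_))
    exact main _ (by positivity)
  · filter_upwards [ae_ne_zero hN] with x hx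
    refine tendsto_const_nhds.congr' ?_
    have := tendsto_one_div_add_atTop_nhds_zero_nat (𝕜 := ℝ)
    filter_upwards [this.eventually_lt_const (norm_pos_iff.2 hx)] with n hn
    rw [Set.indicator_of_mem]
    exact hn

/-! ### The Hardy inequality passes to the completion. -/

lemma gagliardo_sub (u w : EuclideanSpace ℝ (Fin N) → ℝ) :
    gagliardo N s p β (u - w) = gagliardo N s p β u - gagliardo N s p β w := by
  funext z
  simp only [gagliardo, Pi.sub_apply]
  ring

lemma hardyFun_sub (u w : EuclideanSpace ℝ (Fin N) → ℝ) :
    hardyFun N s p β (u - w) = hardyFun N s p β u - hardyFun N s p β w := by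
  funext z
  simp only [hardyFun, Pi.sub_apply]
  ring

lemma lpFun_sub (u w : EuclideanSpace ℝ (Fin N) → ℝ) :
    lpFun N p β (u - w) = lpFun N p β u - lpFun N p β w := by
  funext z
  simp only [lpFun, Pi.sub_apply]
  ring

lemma aestronglyMeasurable_of_mem_testFunctions {φ : EuclideanSpace ℝ (Fin N) → ℝ}
    (hφ : φ ∈ testFunctions N) : AEStronglyMeasurable φ volume :=
  hφ.1.continuous.aestronglyMeasurable

lemma eLpNorm'_lpFun_ne_top_of_mem_testFunctions (hN : 1 ≤ N) (hp : 0 < p) (hβ : 2 * β < N)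
    {φ : EuclideanSpace ℝ (Fin N) → ℝ} (hφ : φ ∈ testFunctions N) :
    eLpNorm' (lpFun N p β φ) p volume ≠ ⊤ := by
  obtain ⟨M, hM⟩ := hφ.2.exists_bound_of_continuous hφ.1.continuous
  obtain ⟨R, hR⟩ := hφ.2.isBounded.subset_ball 0
  have hM0 : 0 ≤ M := (norm_nonneg _).trans (hM 0)
  rw [eLpNorm']
  refine ENNReal.rpow_ne_top_of_nonneg (by positivity) ?_
  have hint : Integrable ((Metric.ball 0 R).indicator
      fun x : EuclideanSpace ℝ (Fin N) => M ^ p * ‖x‖ ^ (-(2 * β))) := by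
    rw [integrable_indicator_iff Metric.isOpen_ball.measurableSet]
    exact (integrableOn_ball_norm_rpow hN (by linarith) R).const_mul _
  refine ne_top_of_le_ne_top hint.lintegral_lt_top.ne (lintegral_mono fun x => ?_)
  dsimp only
  rw [← ofReal_abs_rpow _ hp.le]
  refine ENNReal.ofReal_le_ofReal ?_
  by_cases hx : x ∈ Metric.ball 0 R
  · have h1 := norm_nonneg x
    rw [Set.indicator_of_mem hx, lpFun, abs_mul, Real.mul_rpow (by positivity) (by positivity),
      abs_of_nonneg (Real.rpow_nonneg h1 _), ← Real.rpow_mul h1]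
    have e1 : -2 * β / p * p = -(2 * β) := by field_simp
    rw [e1]
    gcongr
    exact hM x
  · have : φ x = 0 := image_eq_zero_of_notMem_tsupport fun h => hx (hR h)
    rw [Set.indicator_of_notMem hx, lpFun, this, zero_mul, abs_zero, Real.zero_rpow hp.ne']

lemma tendsto_eLpNorm'_of_tendsto_energy (hp : 0 < p)
    {u : EuclideanSpace ℝ (Fin N) → ℝ} (hu : AEStronglyMeasurable u volume)
    {φ : ℕ → EuclideanSpace ℝ (Fin N) → ℝ} (hφ : ∀ n, φ n ∈ testFunctions N)
    (h : Tendsto (fun n => energy N s p β (fun x => φ n x - u x)) atTop (𝓝 0)) :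
    Tendsto (fun n => eLpNorm' (gagliardo N s p β (φ n - u)) p volume) atTop (𝓝 0) := by
  have h1 := (ENNReal.continuous_rpow_const (y := 1 / p)).continuousAt.tendsto.comp h
  rw [ENNReal.zero_rpow_of_pos (by positivity)] at h1
  refine h1.congr fun n => ?_
  have e : (fun x => φ n x - u x) = φ n - u := rfl
  rw [Function.comp_apply, e, energy_eq hp
    ((aestronglyMeasurable_of_mem_testFunctions (hφ n)).sub hu), ← ENNReal.rpow_mul,
    mul_one_div_cancel hp.ne', ENNReal.rpow_one]

/-- The weighted fractional Hardy inequality on the homogeneous space. -/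
lemma exists_hardy_of_mem_spaceD (hN : 1 ≤ N) (hs0 : 0 < s) (hp : 1 ≤ p)
    (hβ1 : β < ((N : ℝ) - p * s) / 2) :
    ∃ K : ℝ≥0∞, K ≠ ⊤ ∧ ∀ u ∈ spaceD N s p β,
      eLpNorm' (hardyFun N s p β u) p volume ≤ K * eLpNorm' (gagliardo N s p β u) p volume := by
  have hp0 : 0 < p := by linarith
  have hps : 0 < p * s := by positivity
  obtain ⟨K, hK, h⟩ := exists_hardy_of_lpFun (N := N) hN hs0 hp hβ1
  refine ⟨K, hK, fun u hu => ?_⟩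
  obtain ⟨hum, -, φ, hφ, hlim, hae⟩ := hu
  have hφm := fun n => aestronglyMeasurable_of_mem_testFunctions (hφ n)
  have hgm := aestronglyMeasurable_gagliardo (s := s) (p := p) (β := β) hum
  have h0 := tendsto_eLpNorm'_of_tendsto_energy hp0 hum hφ hlim
  have hfatou := Lp.eLpNorm'_lim_le_liminf_eLpNorm' (μ := volume) (p := p) hp0
    (f := fun n => hardyFun N s p β (φ n)) (fun n => aestronglyMeasurable_hardyFun (hφm n))
    (f_lim := hardyFun N s p β u) (by
      filter_upwards [hae] with x hx
      exact hx.mul_const _)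
  refine hfatou.trans ?_
  have hub : Tendsto (fun n => K * (eLpNorm' (gagliardo N s p β u) p volume +
      eLpNorm' (gagliardo N s p β (φ n - u)) p volume)) atTop
      (𝓝 (K * (eLpNorm' (gagliardo N s p β u) p volume + 0))) :=
    ENNReal.Tendsto.const_mul (tendsto_const_nhds.add h0) (Or.inr hK)
  rw [add_zero] at hub
  rw [← hub.liminf_eq]
  refine liminf_le_liminf (Eventually.of_forall fun n => ?_)
  refine (h (φ n) (hφm n) (eLpNorm'_lpFun_ne_top_of_mem_testFunctions hN hp0
    (by linarith) (hφ n))).trans ?_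
  gcongr
  rw [gagliardo_sub]
  exact eLpNorm'_le_add_sub hp (aestronglyMeasurable_gagliardo (hφm n)) hgm

/-! ### Density without weights: cut-off and mollification. -/

lemma tendsto_eLpNorm'_zero {α : Type*} [MeasurableSpace α] {μ : Measure α} (hp : 0 < p)
    {f : ℕ → α → ℝ} {B : α → ℝ} (hf : ∀ n, AEStronglyMeasurable (f n) μ)
    (hB : eLpNorm' B p μ ≠ ⊤) (hle : ∀ n, ∀ᵐ x ∂μ, |f n x| ≤ |B x|)
    (hlim : ∀ᵐ x ∂μ, Tendsto (fun n => f n x) atTop (𝓝 0)) :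
    Tendsto (fun n => eLpNorm' (f n) p μ) atTop (𝓝 0) := by
  have h1 : Tendsto (fun n => ∫⁻ x, ‖f n x‖ₑ ^ p ∂μ) atTop (𝓝 (∫⁻ _, 0 ∂μ)) := by
    refine tendsto_lintegral_of_dominated_convergence' (fun x => ‖B x‖ₑ ^ p)
      (fun n => (hf n).enorm.pow_const p) (fun n => ?_) ?_ ?_
    · filter_upwards [hle n] with x hx
      gcongr
      rw [Real.enorm_eq_ofReal_abs, Real.enorm_eq_ofReal_abs]
      exact ENNReal.ofReal_le_ofReal hx
    · rw [lintegral_rpow_enorm_eq_rpow_eLpNorm' hp]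
      finiteness
    · filter_upwards [hlim] with x hx
      have h2 := (ENNReal.continuous_rpow_const (y := p)).continuousAt.tendsto.comp
        ((continuous_enorm (E := ℝ)).continuousAt.tendsto.comp hx)
      simpa [Function.comp_def, ENNReal.zero_rpow_of_pos hp] using h2
  have h3 := (ENNReal.continuous_rpow_const (y := 1 / p)).continuousAt.tendsto.comp h1
  rw [lintegral_zero, ENNReal.zero_rpow_of_pos (by positivity)] at h3
  exact h3

/-- The relative Lipschitz bound, in |x-y|/|x|, is invariant under dilations, so it holds uniformly
for all rescaled cut-offs. For |x| ≤ 4 it follows from the ordinary Lipschitz constant; for |x| ≥ 4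
both values vanish, since |y| ≥ |x|/2 ≥ 2. -/
lemma exists_bump (N : ℕ) : ∃ (g : EuclideanSpace ℝ (Fin N) → ℝ) (L : ℝ), 0 ≤ L ∧ ContDiff ℝ ∞ g ∧
    (∀ x, 0 ≤ g x ∧ g x ≤ 1) ∧ (∀ x, ‖x‖ ≤ 1 → g x = 1) ∧ (∀ x, 2 ≤ ‖x‖ → g x = 0) ∧
    ∀ x y, ‖x - y‖ ≤ ‖x‖ / 2 → |g x - g y| ≤ L * (‖x - y‖ / ‖x‖) := by
  let b : ContDiffBump (0 : EuclideanSpace ℝ (Fin N)) := ⟨1, 2, one_pos, one_lt_two⟩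
  have h0 : ∀ x : EuclideanSpace ℝ (Fin N), 2 ≤ ‖x‖ → b x = 0 := fun x hx =>
    b.zero_of_le_dist (by simpa using hx)
  obtain ⟨C, hC⟩ := b.contDiff.lipschitzWith_of_hasCompactSupport b.hasCompactSupport
    (n := 1) (by norm_num)
  refine ⟨b, C * 4, by positivity, b.contDiff, fun x => ⟨b.nonneg, b.le_one⟩,
    fun x hx => b.one_of_mem_closedBall (by simpa using hx), h0, fun x y hxy => ?_⟩
  rcases eq_or_ne x 0 with rfl | hx
  · have : y = 0 := by simpa using hxy
    simp [this]
  have hr : 0 < ‖x‖ := norm_pos_iff.2 hx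
  rcases le_total ‖x‖ 4 with h4 | h4
  · have h1 := hC.dist_le_mul x y
    rw [Real.dist_eq, dist_eq_norm] at h1
    refine h1.trans ?_
    rw [mul_assoc]
    gcongr
    rw [← mul_div_assoc, le_div_iff₀ hr]
    nlinarith [norm_nonneg (x - y)]
  · have hy : ‖x‖ ≤ ‖y‖ + ‖x - y‖ := by
      simpa using norm_add_le y (x - y)
    rw [h0 x (by linarith), h0 y (by linarith), sub_zero, abs_zero]
    positivity

/-- Cutting off near the origin and near infinity. -/
lemma exists_cutoff (hN : 1 ≤ N) (hs0 : 0 < s) (hs1 : s < 1) (hp : 1 ≤ p)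
    {v : EuclideanSpace ℝ (Fin N) → ℝ} (hv : Measurable v)
    (hg : eLpNorm' (gagliardo N s p 0 v) p volume ≠ ⊤)
    (hh : eLpNorm' (hardyFun N s p 0 v) p volume ≠ ⊤) {ε : ℝ≥0∞} (hε : 0 < ε) :
    ∃ (w : EuclideanSpace ℝ (Fin N) → ℝ) (r R : ℝ), Measurable w ∧ 0 < r ∧
      (∀ x, ‖x‖ < r → w x = 0) ∧ (∀ x, R < ‖x‖ → w x = 0) ∧
      eLpNorm' (gagliardo N s p 0 (w - v)) p volume ≤ ε ∧
      eLpNorm' (hardyFun N s p 0 (w - v)) p volume ≤ ε := by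
  have hp0 : 0 < p := by linarith
  obtain ⟨K, hK, hker⟩ := eLpNorm'_kernel_le (N := N) (s := s) (p := p) (δ := 0) hN hs0 hs1 hp
    (by rw [zero_mul]; have : (1:ℝ) ≤ N := by exact_mod_cast hN
        linarith) hs0
  obtain ⟨g, L, hL0, hgc, hg01, hg1, hg0, hgL⟩ := exists_bump N
  have hgm : Measurable g := hgc.continuous.measurable
  -- Equal to 1 on an annulus growing to all of the space minus the origin, and 0 near 0 and near
  -- infinity.
  set η : ℕ → EuclideanSpace ℝ (Fin N) → ℝ := fun n x =>
    g (((n : ℝ) + 1)⁻¹ • x) - g (((n : ℝ) + 1) • x) with hη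
  have hηm : ∀ n, Measurable (η n) := fun n => by fun_prop
  have hη2 : ∀ n x, |η n x - 1| ≤ 2 := fun n x => by
    have h1 := hg01 (((n : ℝ) + 1)⁻¹ • x)
    have h2 := hg01 (((n : ℝ) + 1) • x)
    simp only [hη]
    rw [abs_le]
    constructor <;> linarith
  have hscale : ∀ (t : ℝ) (x y : EuclideanSpace ℝ (Fin N)), 0 < t → ‖x - y‖ ≤ ‖x‖ / 2 →
      |g (t • x) - g (t • y)| ≤ L * (‖x - y‖ / ‖x‖) := fun t x y ht hxy => by
    have h1 := hgL (t • x) (t • y)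
    rw [← smul_sub, norm_smul, norm_smul, Real.norm_of_nonneg ht.le, mul_div_mul_left _ _ ht.ne'] at h1
    exact h1 (by rw [mul_div_assoc]; gcongr)
  -- Near the diagonal the two bumps contribute 2L; off it the difference is at most 4, while the
  -- kernel with δ = 0 equals 2.
  have hηk : ∀ n x y, |η n x - η n y| ≤ (2 * L + 2) * kernel 0 x y := fun n x y => by
    unfold kernel
    split_ifs with hxy
    · have h1 := abs_le.1 (hscale ((n : ℝ) + 1)⁻¹ x y (by positivity) hxy)
      have h2 := abs_le.1 (hscale ((n : ℝ) + 1) x y (by positivity) hxy)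
      have h3 : 0 ≤ ‖x - y‖ / ‖x‖ := by positivity
      simp only [hη]
      rw [abs_le]
      constructor <;> linarith
    · have h1 := abs_le.1 (hη2 n x)
      have h2 := abs_le.1 (hη2 n y)
      rw [Real.rpow_zero, abs_le]
      constructor <;> linarith
  have hηlim : ∀ x, x ≠ 0 → Tendsto (fun n => η n x) atTop (𝓝 1) := fun x hx => by
    have hr : 0 < ‖x‖ := norm_pos_iff.2 hx
    refine tendsto_const_nhds.congr' ?_
    have ht : Tendsto (fun n : ℕ => (n : ℝ) + 1) atTop atTop :=
      tendsto_natCast_atTop_atTop.atTop_add tendsto_const_nhds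
    filter_upwards [ht.eventually_ge_atTop ‖x‖, ht.eventually_ge_atTop (2 / ‖x‖)] with n h1 h2
    have hn : (0 : ℝ) < (n : ℝ) + 1 := by positivity
    simp only [hη]
    rw [hg1 _ (by rw [norm_smul, norm_inv, Real.norm_of_nonneg hn.le, inv_mul_le_iff₀ hn]; linarith),
      hg0 _ (by rw [norm_smul, Real.norm_of_nonneg hn.le]; rwa [div_le_iff₀ hr] at h2), sub_zero]
  set w : ℕ → EuclideanSpace ℝ (Fin N) → ℝ := fun n x => η n x * v x with hw
  have hwm : ∀ n, Measurable (w n) := fun n => (hηm n).mul hv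
  set Q : EuclideanSpace ℝ (Fin N) × EuclideanSpace ℝ (Fin N) → ℝ := fun z =>
    v z.1 * (kernel 0 z.1 z.2 * ‖z.1 - z.2‖ ^ (-((N : ℝ) / p + s))) with hQ
  have hQm : Measurable Q :=
    (hv.comp measurable_fst).mul ((measurable_kernel 0).mul (by fun_prop))
  have hQtop : eLpNorm' Q p volume ≠ ⊤ :=
    ne_top_of_le_ne_top (by finiteness) (hker v hv.aestronglyMeasurable)
  have hgvm := aestronglyMeasurable_gagliardo (s := s) (p := p) (β := 0) hv.aestronglyMeasurable
  set B : EuclideanSpace ℝ (Fin N) × EuclideanSpace ℝ (Fin N) → ℝ :=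
    (fun z => |((2 : ℝ) • gagliardo N s p 0 v) z|) + fun z => |((2 * L + 2) • Q) z| with hB
  have hBtop : eLpNorm' B p volume ≠ ⊤ := by
    refine ne_top_of_le_ne_top ?_ (eLpNorm'_add_le (hgvm.const_smul (2 : ℝ)).norm
      (hQm.aestronglyMeasurable.const_smul (2 * L + 2)).norm hp)
    have e1 : eLpNorm' (fun z => |((2 : ℝ) • gagliardo N s p 0 v) z|) p volume =
        ‖(2 : ℝ)‖ₑ * eLpNorm' (gagliardo N s p 0 v) p volume :=
      (eLpNorm'_norm (f := (2 : ℝ) • gagliardo N s p 0 v)).trans (eLpNorm'_const_smul _ hp0)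
    have e2 : eLpNorm' (fun z => |((2 * L + 2) • Q) z|) p volume =
        ‖2 * L + 2‖ₑ * eLpNorm' Q p volume :=
      (eLpNorm'_norm (f := (2 * L + 2) • Q)).trans (eLpNorm'_const_smul _ hp0)
    rw [e1, e2]
    finiteness
  have lim1 : Tendsto (fun n => eLpNorm' (gagliardo N s p 0 (w n - v)) p volume) atTop (𝓝 0) := by
    refine tendsto_eLpNorm'_zero hp0 (fun n => aestronglyMeasurable_gagliardo
      ((hwm n).sub hv).aestronglyMeasurable) hBtop (fun n => Eventually.of_forall fun z => ?_) ?_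
    -- Leibniz rule: the first term is dominated by the difference quotient of v, the second by the
    -- kernel term, which the Hardy norm controls uniformly in n.
    · have e : gagliardo N s p 0 (w n - v) z = (η n z.2 - 1) * gagliardo N s p 0 v z +
          (η n z.1 - η n z.2) * (v z.1 * ‖z.1 - z.2‖ ^ (-((N : ℝ) / p + s))) := by
        simp only [gagliardo, hw, Pi.sub_apply, neg_zero, zero_div, Real.rpow_zero, one_mul]
        ring
      rw [e, hB, Pi.add_apply]
      refine le_trans ?_ (le_abs_self _)
      refine (abs_add_le _ _).trans (add_le_add ?_ ?_)
      · rw [Pi.smul_apply, smul_eq_mul, abs_mul, abs_mul, abs_two]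
        gcongr
        exact hη2 n z.2
      · have hk := kernel_nonneg 0 z.1 z.2
        rw [Pi.smul_apply, smul_eq_mul, hQ, abs_mul, abs_mul, abs_mul, abs_mul, abs_mul,
          abs_of_nonneg hk, abs_of_nonneg (by positivity : 0 ≤ 2 * L + 2)]
        refine (mul_le_mul_of_nonneg_right (hηk n z.1 z.2) (by positivity)).trans (le_of_eq ?_)
        ring
    · filter_upwards [ae_prod_ne_zero hN] with z hz
      have h1 := (((hηlim z.1 hz.1).sub_const 1).mul_const (v z.1)).sub
        (((hηlim z.2 hz.2).sub_const 1).mul_const (v z.2))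
      have h2 := h1.mul_const
        (‖z.1‖ ^ (-0 / p) * ‖z.2‖ ^ (-0 / p) * ‖z.1 - z.2‖ ^ (-((N : ℝ) / p + s)))
      simp only [sub_self, zero_mul] at h2
      refine h2.congr fun n => ?_
      simp only [gagliardo, hw, Pi.sub_apply]
      ring
  have lim2 : Tendsto (fun n => eLpNorm' (hardyFun N s p 0 (w n - v)) p volume) atTop (𝓝 0) := by
    refine tendsto_eLpNorm'_zero hp0 (B := (2 : ℝ) • hardyFun N s p 0 v)
      (fun n => aestronglyMeasurable_hardyFun ((hwm n).sub hv).aestronglyMeasurable) ?_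
      (fun n => Eventually.of_forall fun x => ?_) ?_
    · rw [eLpNorm'_const_smul _ hp0]
      finiteness
    · have e : hardyFun N s p 0 (w n - v) x = (η n x - 1) * hardyFun N s p 0 v x := by
        simp only [hardyFun, hw, Pi.sub_apply]
        ring
      rw [e, Pi.smul_apply, smul_eq_mul, abs_mul, abs_mul, abs_two]
      gcongr
      exact hη2 n x
    · filter_upwards [ae_ne_zero hN] with x hx
      have h1 := ((hηlim x hx).sub_const 1).mul_const (hardyFun N s p 0 v x)
      simp only [sub_self, zero_mul] at h1
      refine h1.congr fun n => ?_
      simp only [hardyFun, hw, Pi.sub_apply]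
      ring
  obtain ⟨n, h1, h2⟩ := ((lim1.eventually_le_const hε).and (lim2.eventually_le_const hε)).exists
  have hn : (0 : ℝ) < (n : ℝ) + 1 := by positivity
  have hn1 : (1 : ℝ) ≤ (n : ℝ) + 1 := by linarith [(Nat.cast_nonneg n : (0 : ℝ) ≤ n)]
  refine ⟨w n, ((n : ℝ) + 1)⁻¹, 2 * ((n : ℝ) + 1), hwm n, by positivity, fun x hx => ?_,
    fun x hx => ?_, h1, h2⟩
  · have h3 : ‖((n : ℝ) + 1) • x‖ ≤ 1 := by
      rw [norm_smul, Real.norm_of_nonneg hn.le]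
      have := mul_lt_mul_of_pos_left hx hn
      rw [mul_inv_cancel₀ hn.ne'] at this
      exact this.le
    have h4 : ‖((n : ℝ) + 1)⁻¹ • x‖ ≤ 1 := by
      rw [norm_smul, norm_inv, Real.norm_of_nonneg hn.le, inv_mul_le_iff₀ hn, mul_one]
      have : ((n : ℝ) + 1)⁻¹ ≤ 1 := inv_le_one_of_one_le₀ hn1
      linarith
    simp only [hw, hη]
    rw [hg1 _ h3, hg1 _ h4, sub_self, zero_mul]
  · have h3 : 2 ≤ ‖((n : ℝ) + 1) • x‖ := by
      rw [norm_smul, Real.norm_of_nonneg hn.le]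
      nlinarith
    have h4 : 2 ≤ ‖((n : ℝ) + 1)⁻¹ • x‖ := by
      rw [norm_smul, norm_inv, Real.norm_of_nonneg hn.le, inv_mul_eq_div, le_div_iff₀ hn]
      exact hx.le
    simp only [hw, hη]
    rw [hg0 _ h3, hg0 _ h4, sub_self, zero_mul]

lemma memLp_ofReal_iff {α : Type*} [MeasurableSpace α] {μ : Measure α} (hp : 0 < p) {f : α → ℝ}
    (hf : AEStronglyMeasurable f μ) : MemLp f (ENNReal.ofReal p) μ ↔ eLpNorm' f p μ ≠ ⊤ := by
  rw [MemLp, eLpNorm_eq_eLpNorm' (by simpa using hp) ENNReal.ofReal_ne_top,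
    ENNReal.toReal_ofReal hp.le, lt_top_iff_ne_top]
  exact and_iff_right hf

/-- Translations are continuous in `L^p`. -/
lemma exists_eLpNorm'_translate_le {G : Type*} [NormedAddCommGroup G] [NormedSpace ℝ G]
    [FiniteDimensional ℝ G] [MeasurableSpace G] [BorelSpace G] {μ : Measure G} [μ.IsAddHaarMeasure]
    (hp : 1 ≤ p) {f : G → ℝ} (hf : AEStronglyMeasurable f μ) (hfin : eLpNorm' f p μ ≠ ⊤)
    {ε : ℝ≥0∞} (hε : 0 < ε) :
    ∃ δ : ℝ, 0 < δ ∧ ∀ h : G, ‖h‖ < δ → eLpNorm' (fun z => f (z - h) - f z) p μ ≤ ε := by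
  have hp0 : 0 < p := by linarith
  have : Fact ((1 : ℝ≥0∞) ≤ ENNReal.ofReal p) := ⟨by simpa using hp⟩
  have : Fact (ENNReal.ofReal p ≠ ⊤) := ⟨ENNReal.ofReal_ne_top⟩
  have hmem := (memLp_ofReal_iff hp0 hf).2 hfin
  have hcont : Continuous fun h : G => DomAddAct.mk h +ᵥ hmem.toLp f :=
    (DomAddAct.continuous_mk).vadd continuous_const
  have hlim : Tendsto (fun h : G => edist (DomAddAct.mk h +ᵥ hmem.toLp f)
      (DomAddAct.mk (0 : G) +ᵥ hmem.toLp f)) (𝓝 0) (𝓝 0) := by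
    have := (hcont.edist (continuous_const (y := DomAddAct.mk (0 : G) +ᵥ hmem.toLp f))).tendsto 0
    rwa [edist_self] at this
  obtain ⟨δ, hδ, hball⟩ := Metric.eventually_nhds_iff.1 (hlim.eventually_le_const hε)
  refine ⟨δ, hδ, fun h hh => ?_⟩
  have h1 := hball (y := -h) (by simpa using hh)
  rw [DomAddAct.mk_vadd_toLp, DomAddAct.mk_vadd_toLp, Lp.edist_toLp_toLp,
    eLpNorm_eq_eLpNorm' (by simpa using hp0) ENNReal.ofReal_ne_top, ENNReal.toReal_ofReal hp0.le] at h1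
  refine le_trans (le_of_eq ?_) h1
  congr 1
  funext z
  simp [sub_eq_neg_add]

/-- Jensen's inequality for a probability density. -/
lemma lintegral_mul_rpow_le {α : Type*} [MeasurableSpace α] {μ : Measure α} (hp : 1 ≤ p)
    {ρ : α → ℝ≥0∞} (hρ : Measurable ρ) (hρ1 : ∫⁻ t, ρ t ∂μ = 1) {f : α → ℝ≥0∞} (hf : Measurable f) :
    (∫⁻ t, ρ t * f t ∂μ) ^ p ≤ ∫⁻ t, ρ t * f t ^ p ∂μ := by
  have hp0 : 0 < p := by linarith
  have : IsProbabilityMeasure (μ.withDensity ρ) :=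
    ⟨by rw [withDensity_apply _ MeasurableSet.univ, setLIntegral_univ, hρ1]⟩
  have h := eLpNorm'_le_eLpNorm'_of_exponent_le one_pos hp (μ.withDensity ρ)
    hf.aestronglyMeasurable
  rw [eLpNorm'_eq_lintegral_enorm, eLpNorm'_eq_lintegral_enorm] at h
  simp only [enorm_eq_self, ENNReal.rpow_one, one_div_one] at h
  rw [lintegral_withDensity_eq_lintegral_mul _ hρ hf,
    lintegral_withDensity_eq_lintegral_mul _ hρ (hf.pow_const p)] at h
  rw [← ENNReal.rpow_le_rpow_iff hp0, ← ENNReal.rpow_mul, one_div_mul_cancel hp0.ne',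
    ENNReal.rpow_one] at h
  exact h

/-- The unweighted difference quotient commutes with translations of x and y together, so mollifying
w averages its quotient along the diagonal of the product space. Continuity of translations in L^p
and Jensen's inequality conclude. -/
lemma exists_mollify (hp : 1 ≤ p)
    {w : EuclideanSpace ℝ (Fin N) → ℝ} (hw : Measurable w)
    (hg : eLpNorm' (gagliardo N s p 0 w) p volume ≠ ⊤) (hl : eLpNorm' w p volume ≠ ⊤)
    {r R : ℝ} (hr : 0 < r) (hw0 : ∀ x, ‖x‖ < r → w x = 0) (hwR : ∀ x, R < ‖x‖ → w x = 0)
    {ε : ℝ≥0∞} (hε : 0 < ε) :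
    ∃ φ ∈ testFunctions N, (∀ x, ‖x‖ < r / 2 → φ x = 0) ∧
      eLpNorm' (gagliardo N s p 0 (φ - w)) p volume ≤ ε := by
  have hp0 : 0 < p := by linarith
  set V := gagliardo N s p 0 w with hV
  have hVm : Measurable V := by
    rw [hV]; unfold gagliardo
    exact ((hw.comp measurable_fst).sub (hw.comp measurable_snd)).mul (by fun_prop)
  have hVm' : AEStronglyMeasurable V
      ((volume : Measure (EuclideanSpace ℝ (Fin N))).prod volume) := hVm.aestronglyMeasurable
  obtain ⟨δ, hδ, hδV⟩ := exists_eLpNorm'_translate_le hp hVm' hg hε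
  -- The radius is below δ for the translation estimate and at most r/2 so that the result still
  -- vanishes near the origin.
  set d := min δ (r / 2) with hd
  have hd0 : 0 < d := lt_min hδ (by positivity)
  let b : ContDiffBump (0 : EuclideanSpace ℝ (Fin N)) := ⟨d / 2, d, by positivity, by linarith⟩
  set ρ : EuclideanSpace ℝ (Fin N) → ℝ := b.normed volume with hρ
  have hρ0 : ∀ t, 0 ≤ ρ t := fun t => b.nonneg_normed t
  have hρc : Continuous ρ := b.continuous_normed
  have hρs : ∀ t, ρ t ≠ 0 → ‖t‖ < d := fun t ht => by
    have : t ∈ Function.support (b.normed volume) := ht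
    rw [b.support_normed_eq] at this
    simpa using this
  have hρi : Integrable ρ := b.integrable_normed
  have hρ1 : ∫ t, ρ t = 1 := b.integral_normed
  have hwi : Integrable w := by
    refine memLp_one_iff_integrable.1
      (((memLp_ofReal_iff hp0 hw.aestronglyMeasurable).2 hl).mono_exponent_of_measure_support_ne_top
        (s := Metric.closedBall 0 R) (fun x hx => hwR x ?_) measure_closedBall_lt_top.ne
        (by simpa using hp))
    simpa using hx
  set φ : EuclideanSpace ℝ (Fin N) → ℝ :=
    convolution ρ w (ContinuousLinearMap.lsmul ℝ ℝ) volume with hφ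
  have hφx : ∀ x, φ x = ∫ t, ρ t * w (x - t) := fun x => rfl
  obtain ⟨M, hM⟩ := b.hasCompactSupport_normed.exists_bound_of_continuous hρc
  have hint : ∀ x, Integrable fun t => ρ t * w (x - t) := fun x =>
    (hwi.comp_sub_left x).bdd_mul hρc.aestronglyMeasurable (Eventually.of_forall hM)
  refine ⟨φ, ⟨?_, ?_⟩, fun x hx => ?_, ?_⟩
  · exact HasCompactSupport.contDiff_convolution_left (n := ⊤) _ b.hasCompactSupport_normed
      b.contDiff_normed hwi.locallyIntegrable
  · refine HasCompactSupport.intro (isCompact_closedBall 0 (R + d)) fun x hx => ?_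
    rw [hφx, ← integral_zero (EuclideanSpace ℝ (Fin N)) ℝ (μ := volume)]
    congr 1
    funext t
    by_cases ht : ρ t = 0
    · rw [ht, zero_mul]
    · have h1 := hρs t ht
      have h2 : R + d < ‖x‖ := by simpa using hx
      have h3 : ‖x‖ ≤ ‖x - t‖ + ‖t‖ := by simpa using norm_add_le (x - t) t
      rw [hwR (x - t) (by linarith), mul_zero]
  · rw [hφx, ← integral_zero (EuclideanSpace ℝ (Fin N)) ℝ (μ := volume)]
    congr 1
    funext t
    by_cases ht : ρ t = 0
    · rw [ht, zero_mul]
    · have h1 := hρs t ht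
      have h2 : d ≤ r / 2 := min_le_right _ _
      rw [hw0 (x - t) ((norm_sub_le x t).trans_lt (by linarith)), mul_zero]
  · have hD : ∀ z : EuclideanSpace ℝ (Fin N) × EuclideanSpace ℝ (Fin N),
        gagliardo N s p 0 (φ - w) z = ∫ t, ρ t * (V (z - (t, t)) - V z) := by
      intro z
      set W := ‖z.1‖ ^ (-0 / p) * ‖z.2‖ ^ (-0 / p) * ‖z.1 - z.2‖ ^ (-((N : ℝ) / p + s)) with hW
      have e1 : ∀ t, ρ t * (V (z - (t, t)) - V z) =
          ((ρ t * w (z.1 - t) - ρ t * w z.1) - (ρ t * w (z.2 - t) - ρ t * w z.2)) * W := by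
        intro t
        simp only [hV, hW, gagliardo, Prod.fst_sub, Prod.snd_sub, sub_sub_sub_cancel_right, neg_zero,
          zero_div, Real.rpow_zero, one_mul]
        ring
      have hi : ∀ x, Integrable fun t => ρ t * w (x - t) - ρ t * w x := fun x =>
        (hint x).sub (hρi.mul_const _)
      simp only [e1]
      rw [integral_mul_const, integral_sub (hi z.1) (hi z.2), integral_sub (hint z.1) (hρi.mul_const _),
        integral_sub (hint z.2) (hρi.mul_const _), integral_mul_const, integral_mul_const, hρ1,
        one_mul, one_mul, ← hφx, ← hφx]
      rfl
    have hρL : ∫⁻ t, ENNReal.ofReal (ρ t) = 1 := by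
      rw [← ofReal_integral_eq_lintegral_ofReal hρi (Eventually.of_forall hρ0), hρ1,
        ENNReal.ofReal_one]
    have hVd : Measurable fun q : (EuclideanSpace ℝ (Fin N) × EuclideanSpace ℝ (Fin N)) ×
        EuclideanSpace ℝ (Fin N) => V (q.1 - (q.2, q.2)) - V q.1 :=
      (hVm.comp (by fun_prop)).sub (hVm.comp measurable_fst)
    have hρm : Measurable fun t => ENNReal.ofReal (ρ t) := by fun_prop
    rw [← ENNReal.rpow_le_rpow_iff hp0, ← lintegral_rpow_enorm_eq_rpow_eLpNorm' hp0]
    calc ∫⁻ z, ‖gagliardo N s p 0 (φ - w) z‖ₑ ^ p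
        ≤ ∫⁻ z, ∫⁻ t, ENNReal.ofReal (ρ t) * ‖V (z - (t, t)) - V z‖ₑ ^ p := by
          refine lintegral_mono fun z => ?_
          refine le_trans ?_ (lintegral_mul_rpow_le hp hρm hρL
            (hVd.comp (measurable_prodMk_left (x := z))).enorm)
          gcongr
          rw [hD]
          refine (enorm_integral_le_lintegral_enorm _).trans (le_of_eq ?_)
          refine lintegral_congr fun t => ?_
          rw [enorm_mul, Real.enorm_eq_ofReal (hρ0 t)]
      _ = ∫⁻ t, ∫⁻ z, ENNReal.ofReal (ρ t) * ‖V (z - (t, t)) - V z‖ₑ ^ p := by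
          refine lintegral_lintegral_swap (Measurable.aemeasurable ?_)
          exact (hρm.comp measurable_snd).mul (hVd.enorm.pow_const p)
      _ ≤ ∫⁻ t, ENNReal.ofReal (ρ t) * ε ^ p := by
          refine lintegral_mono fun t => ?_
          dsimp only
          rw [lintegral_const_mul' _ _ ENNReal.ofReal_ne_top]
          by_cases ht : ρ t = 0
          · simp [ht]
          gcongr
          rw [lintegral_rpow_enorm_eq_rpow_eLpNorm' hp0]
          gcongr
          refine hδV (t, t) ?_
          rw [Prod.norm_mk, max_self]
          exact (hρs t ht).trans_le (min_le_left _ _)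
      _ = ε ^ p := by
          rw [lintegral_mul_const _ hρm, hρL, one_mul]

/-- Smooth functions with compact support away from the origin are dense, unweighted case. -/
lemma exists_testFunctions_near (hN : 1 ≤ N) (hs0 : 0 < s) (hs1 : s < 1) (hp : 1 ≤ p)
    (hps : p * s < N) {v : EuclideanSpace ℝ (Fin N) → ℝ} (hv : AEStronglyMeasurable v volume)
    (hg : eLpNorm' (gagliardo N s p 0 v) p volume ≠ ⊤)
    (hh : eLpNorm' (hardyFun N s p 0 v) p volume ≠ ⊤) {ε : ℝ≥0∞} (hε : 0 < ε) (hεt : ε ≠ ⊤) :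
    ∃ φ ∈ testFunctions N, (∃ r : ℝ, 0 < r ∧ ∀ x, ‖x‖ < r → φ x = 0) ∧
      eLpNorm' (gagliardo N s p 0 (φ - v)) p volume ≤ ε ∧
      eLpNorm' (hardyFun N s p 0 (φ - v)) p volume ≤ ε := by
  have hp0 : 0 < p := by linarith
  wlog hvm : Measurable v generalizing v
  · have hae : v =ᵐ[volume] hv.mk v := hv.ae_eq_mk
    have hG : ∀ {u u' : EuclideanSpace ℝ (Fin N) → ℝ}, u =ᵐ[volume] u' →
        eLpNorm' (gagliardo N s p 0 u) p volume = eLpNorm' (gagliardo N s p 0 u') p volume := by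
      intro u u' huu
      refine eLpNorm'_congr_ae ?_
      have h1 := Measure.quasiMeasurePreserving_fst
        (μ := (volume : Measure (EuclideanSpace ℝ (Fin N))))
        (ν := (volume : Measure (EuclideanSpace ℝ (Fin N)))).ae huu
      have h2 := Measure.quasiMeasurePreserving_snd
        (μ := (volume : Measure (EuclideanSpace ℝ (Fin N))))
        (ν := (volume : Measure (EuclideanSpace ℝ (Fin N)))).ae huu
      rw [← Measure.volume_eq_prod] at h1 h2
      filter_upwards [h1, h2] with z hz1 hz2
      simp only [gagliardo, hz1, hz2]
    have hH : ∀ {u u' : EuclideanSpace ℝ (Fin N) → ℝ}, u =ᵐ[volume] u' →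
        eLpNorm' (hardyFun N s p 0 u) p volume = eLpNorm' (hardyFun N s p 0 u') p volume := by
      intro u u' huu
      refine eLpNorm'_congr_ae ?_
      filter_upwards [huu] with x hx
      rw [hardyFun, hardyFun, hx]
    obtain ⟨φ, hφ, h0, h1, h2⟩ := this hv.stronglyMeasurable_mk.aestronglyMeasurable
      (by rwa [← hG hae]) (by rwa [← hH hae]) hv.stronglyMeasurable_mk.measurable
    refine ⟨φ, hφ, h0, ?_, ?_⟩
    · rwa [hG ((ae_eq_refl φ).sub hae)]
    · rwa [hH ((ae_eq_refl φ).sub hae)]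
  obtain ⟨K, hK, hKh⟩ := exists_hardy_of_lpFun (N := N) (s := s) (p := p) (β := 0) hN hs0 hp
    (by linarith)
  have hε2 : 0 < ε / 2 := ENNReal.half_pos hε.ne'
  obtain ⟨w, r, R, hwm, hr, hw0, hwR, h1, h2⟩ := exists_cutoff hN hs0 hs1 hp hvm hg hh hε2
  -- The Hardy inequality costs a factor K; K + 1 is nonzero and at least 1, so both norms stay
  -- below ε/2.
  have hε3 : 0 < ε / 2 / (K + 1) := ENNReal.div_pos hε2.ne' (by finiteness)
  have hgw : eLpNorm' (gagliardo N s p 0 w) p volume ≠ ⊤ := by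
    refine ne_top_of_le_ne_top ?_ (eLpNorm'_le_add_sub hp
      (aestronglyMeasurable_gagliardo hwm.aestronglyMeasurable)
      (aestronglyMeasurable_gagliardo (s := s) (p := p) (β := 0) hv))
    rw [← gagliardo_sub]
    exact ENNReal.add_ne_top.2 ⟨hg, ne_top_of_le_ne_top (by finiteness) h1⟩
  have hhw : eLpNorm' (hardyFun N s p 0 w) p volume ≠ ⊤ := by
    refine ne_top_of_le_ne_top ?_ (eLpNorm'_le_add_sub hp
      (aestronglyMeasurable_hardyFun hwm.aestronglyMeasurable)
      (aestronglyMeasurable_hardyFun (s := s) (p := p) (β := 0) hv))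
    rw [← hardyFun_sub]
    exact ENNReal.add_ne_top.2 ⟨hh, ne_top_of_le_ne_top (by finiteness) h2⟩
  have hlw : eLpNorm' w p volume ≠ ⊤ := by
    refine ne_top_of_le_ne_top (ENNReal.mul_ne_top (ENNReal.ofReal_ne_top (r := |R| ^ s)) hhw)
      (eLpNorm'_le_mul_eLpNorm'_of_ae_le_mul
        (aestronglyMeasurable_hardyFun hwm.aestronglyMeasurable)
        (Eventually.of_forall fun x => ?_) hp0)
    rcases lt_or_ge ‖x‖ r with hx | hx
    · rw [hw0 x hx, enorm_zero]; exact zero_le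
    rcases lt_or_ge R ‖x‖ with hx2 | hx2
    · rw [hwR x hx2, enorm_zero]; exact zero_le
    have hx0 : 0 < ‖x‖ := by linarith
    rw [Real.enorm_eq_ofReal_abs, Real.enorm_eq_ofReal_abs, ← ENNReal.ofReal_mul (by positivity)]
    refine ENNReal.ofReal_le_ofReal ?_
    rw [hardyFun, mul_zero, zero_div, add_zero, abs_mul, abs_of_nonneg (by positivity : 0 ≤ ‖x‖ ^ (-s)),
      mul_left_comm]
    refine le_mul_of_one_le_right (abs_nonneg _) ?_
    rw [Real.rpow_neg hx0.le, ← div_eq_mul_inv, one_le_div (by positivity)]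
    exact Real.rpow_le_rpow hx0.le (hx2.trans (le_abs_self R)) hs0.le
  obtain ⟨φ, hφ, hφ0, h3⟩ := exists_mollify (s := s) hp hwm hgw hlw hr hw0 hwR hε3
  have hφm := aestronglyMeasurable_of_mem_testFunctions hφ
  have hlp : ∀ u : EuclideanSpace ℝ (Fin N) → ℝ, lpFun N p 0 u = u := fun u => by
    funext x
    simp [lpFun]
  have h4 : eLpNorm' (hardyFun N s p 0 (φ - w)) p volume ≤ ε / 2 := by
    refine (hKh (φ - w) (hφm.sub hwm.aestronglyMeasurable) ?_).trans ?_
    · have hφt := eLpNorm'_lpFun_ne_top_of_mem_testFunctions (p := p) (β := 0) hN hp0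
        (by rw [mul_zero]; exact_mod_cast hN) hφ
      rw [hlp] at hφt ⊢
      have := eLpNorm'_add_le (q := p) hφm hwm.aestronglyMeasurable.neg hp
      rw [eLpNorm'_neg, ← sub_eq_add_neg] at this
      exact ne_top_of_le_ne_top (ENNReal.add_ne_top.2 ⟨hφt, hlw⟩) this
    · calc K * eLpNorm' (gagliardo N s p 0 (φ - w)) p volume
          ≤ (K + 1) * (ε / 2 / (K + 1)) := by gcongr; exact le_self_add
        _ = ε / 2 := ENNReal.mul_div_cancel (by simp) (by finiteness)
  have h3' : eLpNorm' (gagliardo N s p 0 (φ - w)) p volume ≤ ε / 2 :=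
    h3.trans (ENNReal.div_le_of_le_mul (le_mul_of_one_le_right zero_le (by simp)))
  refine ⟨φ, hφ, ⟨r / 2, by positivity, hφ0⟩, ?_, ?_⟩
  · rw [← sub_add_sub_cancel φ w v]
    have e : gagliardo N s p 0 (φ - w + (w - v)) =
        gagliardo N s p 0 (φ - w) + gagliardo N s p 0 (w - v) := by
      funext z
      simp only [gagliardo, Pi.add_apply]
      ring
    rw [e]
    refine (eLpNorm'_add_le (aestronglyMeasurable_gagliardo (hφm.sub hwm.aestronglyMeasurable))
      (aestronglyMeasurable_gagliardo (hwm.sub hvm).aestronglyMeasurable) hp).trans ?_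
    exact (add_le_add h3' h1).trans (ENNReal.add_halves ε).le
  · rw [← sub_add_sub_cancel φ w v]
    have e : hardyFun N s p 0 (φ - w + (w - v)) =
        hardyFun N s p 0 (φ - w) + hardyFun N s p 0 (w - v) := by
      funext z
      simp only [hardyFun, Pi.add_apply]
      ring
    rw [e]
    refine (eLpNorm'_add_le (aestronglyMeasurable_hardyFun (hφm.sub hwm.aestronglyMeasurable))
      (aestronglyMeasurable_hardyFun (hwm.sub hvm).aestronglyMeasurable) hp).trans ?_
    exact (add_le_add h4 h2).trans (ENNReal.add_halves ε).le

/-! ### The homogeneous space as finite energy plus finite Hardy norm. -/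

lemma mul_norm_rpow_mem_testFunctions {φ : EuclideanSpace ℝ (Fin N) → ℝ}
    (hφ : φ ∈ testFunctions N) {r : ℝ} (hr : 0 < r) (hφ0 : ∀ x, ‖x‖ < r → φ x = 0) (c : ℝ) :
    (fun x => φ x * ‖x‖ ^ c) ∈ testFunctions N := by
  refine ⟨contDiff_iff_contDiffAt.2 fun x => ?_, hφ.2.mul_right⟩
  rcases eq_or_ne x 0 with rfl | hx
  · refine (contDiffAt_const (c := (0 : ℝ))).congr_of_eventuallyEq ?_
    filter_upwards [Metric.ball_mem_nhds (0 : EuclideanSpace ℝ (Fin N)) hr] with y hy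
    rw [hφ0 y (by simpa using hy), zero_mul]
  · exact hφ.1.contDiffAt.mul ((contDiffAt_norm ℝ hx).rpow_const_of_ne (norm_ne_zero_iff.2 hx))

lemma energy_lt_top_iff (hp : 0 < p) {u : EuclideanSpace ℝ (Fin N) → ℝ}
    (hu : AEStronglyMeasurable u volume) :
    energy N s p β u < ⊤ ↔ eLpNorm' (gagliardo N s p β u) p volume ≠ ⊤ := by
  rw [energy_eq hp hu, ENNReal.rpow_lt_top_iff_of_pos hp, lt_top_iff_ne_top]

lemma lpEnergy_lt_top_iff (hp : 0 < p) (u : EuclideanSpace ℝ (Fin N) → ℝ) :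
    lpEnergy N p β u < ⊤ ↔ eLpNorm' (lpFun N p β u) p volume ≠ ⊤ := by
  rw [lpEnergy_eq hp, ENNReal.rpow_lt_top_iff_of_pos hp, lt_top_iff_ne_top]

lemma exists_gagliardo_comparison (hN : 1 ≤ N) (hs0 : 0 < s) (hs1 : s < 1) (hp : 1 ≤ p)
    (hβ0 : -(p * s) < β) (hβ1 : β < N) :
    ∃ K : ℝ≥0∞, K ≠ ⊤ ∧ ∀ u : EuclideanSpace ℝ (Fin N) → ℝ, AEStronglyMeasurable u volume →
      eLpNorm' (gagliardo N s p β u) p volume ≤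
        eLpNorm' (gagliardo N s p 0 (lpFun N p β u)) p volume +
          K * eLpNorm' (hardyFun N s p β u) p volume ∧
      eLpNorm' (gagliardo N s p 0 (lpFun N p β u)) p volume ≤
        eLpNorm' (gagliardo N s p β u) p volume +
          K * eLpNorm' (hardyFun N s p β u) p volume := by
  obtain ⟨K, hK, h⟩ := exists_eLpNorm'_gagliardo_sub_le (N := N) hN hs0 hs1 hp hβ0 hβ1
  refine ⟨K, hK, fun u hu => ⟨?_, ?_⟩⟩
  · exact (eLpNorm'_le_add_sub hp (aestronglyMeasurable_gagliardo hu)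
      (aestronglyMeasurable_gagliardo (aestronglyMeasurable_lpFun hu))).trans
      (add_le_add_right (h u hu) _)
  · refine (eLpNorm'_le_add_sub hp (aestronglyMeasurable_gagliardo (aestronglyMeasurable_lpFun hu))
      (aestronglyMeasurable_gagliardo (s := s) (p := p) (β := β) hu)).trans ?_
    rw [eLpNorm'_sub_comm]
    exact add_le_add_right (h u hu) _

/-- Approximate v = |x|^α u by test functions vanishing near 0, divide by |x|^α, and apply the
comparison to the error: its energy is bounded by the unweighted energy and the Hardy norm, both
small. -/
lemma mem_spaceD_of_ne_top (hN : 1 ≤ N) (hs0 : 0 < s) (hs1 : s < 1) (hp : 1 ≤ p)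
    (hps : p * s < N) (hβ0 : -(p * s) < β) (hβ1 : β < N)
    {u : EuclideanSpace ℝ (Fin N) → ℝ} (hu : AEStronglyMeasurable u volume)
    (hg : eLpNorm' (gagliardo N s p β u) p volume ≠ ⊤)
    (hh : eLpNorm' (hardyFun N s p β u) p volume ≠ ⊤) : u ∈ spaceD N s p β := by
  have hp0 : 0 < p := by linarith
  obtain ⟨K, hK, hcmp⟩ := exists_gagliardo_comparison (N := N) hN hs0 hs1 hp hβ0 hβ1
  set v := lpFun N p β u with hv
  have hvm : AEStronglyMeasurable v volume := aestronglyMeasurable_lpFun hu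
  have hgv : eLpNorm' (gagliardo N s p 0 v) p volume ≠ ⊤ :=
    ne_top_of_le_ne_top (by finiteness) (hcmp u hu).2
  have hhv : eLpNorm' (hardyFun N s p 0 v) p volume ≠ ⊤ := by
    rwa [← eLpNorm'_congr_ae (hardyFun_lpFun_ae_eq hN u)]
  have hex := fun n : ℕ => exists_testFunctions_near (ε := ((n : ℝ≥0∞) + 1)⁻¹) hN hs0 hs1 hp hps hvm
    hgv hhv (ENNReal.inv_pos.2 (by finiteness)) (by simp)
  choose φ hφ hφ0 hφg hφh using hex
  choose r hr hφr using hφ0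
  set ψ : ℕ → EuclideanSpace ℝ (Fin N) → ℝ := fun n x => φ n x * ‖x‖ ^ (2 * β / p) with hψ
  have hψt : ∀ n, ψ n ∈ testFunctions N := fun n =>
    mul_norm_rpow_mem_testFunctions (hφ n) (hr n) (hφr n) _
  have hψm := fun n => aestronglyMeasurable_of_mem_testFunctions (hψt n)
  have hlp : ∀ n, lpFun N p β (ψ n - u) = φ n - v := fun n => by
    rw [lpFun_sub, ← hv]
    congr 1
    funext x
    rcases eq_or_ne x 0 with rfl | hx
    -- At the origin the powers of |x| need not cancel, but the approximant vanishes there.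
    · simp [lpFun, hψ, hφr n 0 (by simpa using hr n)]
    · have hx0 : 0 < ‖x‖ := norm_pos_iff.2 hx
      simp only [lpFun, hψ]
      rw [mul_assoc, ← Real.rpow_add hx0, neg_mul, neg_div, add_neg_cancel, Real.rpow_zero, mul_one]
  have hH : ∀ n, eLpNorm' (hardyFun N s p β (ψ n - u)) p volume ≤ ((n : ℝ≥0∞) + 1)⁻¹ := fun n => by
    rw [eLpNorm'_congr_ae (hardyFun_lpFun_ae_eq hN (ψ n - u)), hlp]
    exact hφh n
  have hG : ∀ n, eLpNorm' (gagliardo N s p β (ψ n - u)) p volume ≤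
      (1 + K) * ((n : ℝ≥0∞) + 1)⁻¹ := fun n => by
    refine (hcmp _ ((hψm n).sub hu)).1.trans ?_
    rw [hlp, add_mul, one_mul]
    exact add_le_add (hφg n) (mul_le_mul_right (hH n) _)
  have hinv : Tendsto (fun n : ℕ => ((n : ℝ≥0∞) + 1)⁻¹) atTop (𝓝 0) := by
    have := (tendsto_add_atTop_iff_nat 1).2 ENNReal.tendsto_inv_nat_nhds_zero
    simpa using this
  have hlimH : Tendsto (fun n => eLpNorm' (hardyFun N s p β (ψ n - u)) p volume) atTop (𝓝 0) :=
    tendsto_of_tendsto_of_tendsto_of_le_of_le tendsto_const_nhds hinv (fun _ => zero_le) hH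
  have hlimG : Tendsto (fun n => eLpNorm' (gagliardo N s p β (ψ n - u)) p volume) atTop (𝓝 0) := by
    refine tendsto_of_tendsto_of_tendsto_of_le_of_le tendsto_const_nhds ?_ (fun _ => zero_le) hG
    have := ENNReal.Tendsto.const_mul hinv (Or.inr (by finiteness : 1 + K ≠ ⊤))
    simpa using this
  -- The energy ignores constants; almost everywhere convergence of a subsequence comes from the
  -- Hardy norm.
  have hmeas : TendstoInMeasure volume (fun n => hardyFun N s p β (ψ n)) atTop
      (hardyFun N s p β u) := by
    refine tendstoInMeasure_of_tendsto_eLpNorm (p := ENNReal.ofReal p) (by simpa using hp0)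
      (fun n => aestronglyMeasurable_hardyFun (hψm n)) (aestronglyMeasurable_hardyFun hu) ?_
    refine hlimH.congr fun n => ?_
    rw [hardyFun_sub, eLpNorm_eq_eLpNorm' (by simpa using hp0) ENNReal.ofReal_ne_top,
      ENNReal.toReal_ofReal hp0.le]
  obtain ⟨ns, hns, hae⟩ := hmeas.exists_seq_tendsto_ae
  refine ⟨hu, (energy_lt_top_iff hp0 hu).2 hg, fun k => ψ (ns k), fun k => hψt _, ?_, ?_⟩
  · have h1 := (ENNReal.continuous_rpow_const (y := p)).continuousAt.tendsto.comp
      (hlimG.comp hns.tendsto_atTop)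
    rw [ENNReal.zero_rpow_of_pos hp0] at h1
    refine h1.congr fun k => ?_
    exact (energy_eq hp0 ((hψm (ns k)).sub hu)).symm
  · filter_upwards [hae, ae_ne_zero hN] with x hx hx0
    have hr0 : 0 < ‖x‖ := norm_pos_iff.2 hx0
    have hne : ‖x‖ ^ (-(s + 2 * β / p)) ≠ 0 := by positivity
    have h2 := hx.div_const (‖x‖ ^ (-(s + 2 * β / p)))
    simpa only [hardyFun, mul_div_cancel_right₀ _ hne] using h2

/-- The homogeneous space consists of the functions of finite energy and finite Hardy norm. -/
lemma mem_spaceD_iff (hN : 1 ≤ N) (hs0 : 0 < s) (hs1 : s < 1) (hp : 1 ≤ p)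
    (hps : p * s < N) (hβ0 : -(p * s) < β) (hβ1 : β < ((N : ℝ) - p * s) / 2)
    {u : EuclideanSpace ℝ (Fin N) → ℝ} :
    u ∈ spaceD N s p β ↔ AEStronglyMeasurable u volume ∧
      eLpNorm' (gagliardo N s p β u) p volume ≠ ⊤ ∧
      eLpNorm' (hardyFun N s p β u) p volume ≠ ⊤ := by
  have hp0 : 0 < p := by linarith
  have hps0 : 0 < p * s := by positivity
  refine ⟨fun hu => ?_, fun ⟨h1, h2, h3⟩ =>
    mem_spaceD_of_ne_top hN hs0 hs1 hp hps hβ0 (by linarith) h1 h2 h3⟩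
  obtain ⟨K, hK, h⟩ := exists_hardy_of_mem_spaceD hN hs0 hp hβ1
  have hg := (energy_lt_top_iff hp0 hu.1).1 hu.2.1
  exact ⟨hu.1, hg, ne_top_of_le_ne_top (by finiteness) (h u hu)⟩

/-! ### Equality of the spaces and equivalence of the norms. -/

lemma norm_rpow_mul_eq_lpFun (u : EuclideanSpace ℝ (Fin N) → ℝ) :
    (fun x => ‖x‖ ^ (-2 * β / p) * u x) = lpFun N p β u :=
  funext fun _ => mul_comm _ _

/-- The weight with -β in place of β inverts it off the origin. -/
lemma aestronglyMeasurable_lpFun_iff (hN : 1 ≤ N) {u : EuclideanSpace ℝ (Fin N) → ℝ} :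
    AEStronglyMeasurable (lpFun N p β u) volume ↔ AEStronglyMeasurable u volume := by
  refine ⟨fun h => (aestronglyMeasurable_lpFun (p := p) (β := -β) h).congr ?_,
    aestronglyMeasurable_lpFun⟩
  filter_upwards [ae_ne_zero hN] with x hx
  have hr : 0 < ‖x‖ := norm_pos_iff.2 hx
  have e : -2 * β / p + -2 * -β / p = 0 := by ring
  rw [lpFun, lpFun, mul_assoc, ← Real.rpow_add hr, e, Real.rpow_zero, mul_one]

lemma spaceD_eq_spaceE (hN : 1 ≤ N) (hs0 : 0 < s) (hs1 : s < 1) (hp : 1 ≤ p)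
    (hps : p * s < N) (hβ0 : -(p * s) < β) (hβ1 : β < ((N : ℝ) - p * s) / 2) :
    spaceD N s p β = spaceE N s p (-2 * β / p) := by
  have hps0 : 0 < p * s := by positivity
  obtain ⟨K, hK, hcmp⟩ := exists_gagliardo_comparison (N := N) hN hs0 hs1 hp hβ0 (by linarith)
  ext u
  rw [spaceE, Set.mem_ofPred_eq, norm_rpow_mul_eq_lpFun, mem_spaceD_iff hN hs0 hs1 hp hps hβ0 hβ1,
    mem_spaceD_iff hN hs0 hs1 hp hps (by linarith) (by linarith),
    ← eLpNorm'_congr_ae (hardyFun_lpFun_ae_eq hN u), aestronglyMeasurable_lpFun_iff hN]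
  refine and_congr_right fun hu => and_congr_left fun hh => ⟨fun hg => ?_, fun hg => ?_⟩
  · exact ne_top_of_le_ne_top (by finiteness) (hcmp u hu).2
  · exact ne_top_of_le_ne_top (by finiteness) (hcmp u hu).1

/-- The comparison error is a Hardy norm, bounded through the weighted energy in one direction and
the unweighted one in the other. Constants at least 1 can also multiply the L^p term of the
inhomogeneous norm. -/
lemma exists_norm_equivalence (hN : 1 ≤ N) (hs0 : 0 < s) (hs1 : s < 1) (hp : 1 ≤ p)
    (hps : p * s < N) (hβ0 : -(p * s) < β) (hβ1 : β < ((N : ℝ) - p * s) / 2) :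
    ∃ A B : ℝ, 1 ≤ A ∧ 1 ≤ B ∧ ∀ u ∈ spaceE N s p (-2 * β / p),
      normE N s p (-2 * β / p) u ≤ A * seminorm N s p β u ∧
      seminorm N s p β u ≤ B * normE N s p (-2 * β / p) u := by
  have hp0 : 0 < p := by linarith
  have hps0 : 0 < p * s := by positivity
  obtain ⟨K, hK, hcmp⟩ := exists_gagliardo_comparison (N := N) hN hs0 hs1 hp hβ0 (by linarith)
  obtain ⟨Kβ, hKβ, hhβ⟩ := exists_hardy_of_mem_spaceD hN hs0 hp hβ1
  obtain ⟨K₀, hK₀, hh₀⟩ := exists_hardy_of_mem_spaceD (N := N) (s := s) (p := p) (β := 0) hN hs0 hp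
    (by linarith)
  have hone : ∀ L : ℝ≥0∞, L ≠ ⊤ → 1 ≤ (1 + K * L).toReal := fun L hL => by
    rw [ENNReal.toReal_add (by finiteness) (by finiteness), ENNReal.toReal_one]
    exact le_add_of_nonneg_right ENNReal.toReal_nonneg
  refine ⟨(1 + K * Kβ).toReal, (1 + K * K₀).toReal, hone _ hKβ, hone _ hK₀, fun u hu => ?_⟩
  have huD : u ∈ spaceD N s p β := by rwa [spaceD_eq_spaceE hN hs0 hs1 hp hps hβ0 hβ1]
  have hvD : lpFun N p β u ∈ spaceD N s p 0 := by
    rwa [spaceE, Set.mem_ofPred_eq, norm_rpow_mul_eq_lpFun] at hu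
  have hg := (energy_lt_top_iff hp0 huD.1).1 huD.2.1
  have hgv := (energy_lt_top_iff hp0 hvD.1).1 hvD.2.1
  have h1 := hhβ u huD
  have h0 := hh₀ _ hvD
  rw [← eLpNorm'_congr_ae (hardyFun_lpFun_ae_eq hN u)] at h0
  rw [normE, norm_rpow_mul_eq_lpFun, seminorm_eq hp0 huD.1, seminorm_eq hp0 hvD.1,
    ← ENNReal.toReal_mul, ← ENNReal.toReal_mul]
  refine ⟨ENNReal.toReal_mono (by finiteness) ((hcmp u huD.1).2.trans ?_),
    ENNReal.toReal_mono (by finiteness) ((hcmp u huD.1).1.trans ?_)⟩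
  · rw [add_mul, one_mul, mul_assoc]
    gcongr
  · rw [add_mul, one_mul, mul_assoc]
    gcongr

/-- No approximation enters: the Hardy inequality for functions of finite L^p norm gives membership
in the homogeneous space. -/
lemma spaceW_eq (hN : 1 ≤ N) (hs0 : 0 < s) (hs1 : s < 1) (hp : 1 ≤ p)
    (hps : p * s < N) (hβ0 : -(p * s) < β) (hβ1 : β < ((N : ℝ) - p * s) / 2) :
    spaceW N s p β = {u | u ∈ spaceE N s p (-2 * β / p) ∧ lpEnergy N p β u < ⊤} := by
  have hp0 : 0 < p := by linarith
  obtain ⟨K, hK, h⟩ := exists_hardy_of_lpFun (N := N) hN hs0 hp hβ1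
  ext u
  rw [← spaceD_eq_spaceE hN hs0 hs1 hp hps hβ0 hβ1, spaceW, Set.mem_ofPred_eq, Set.mem_ofPred_eq,
    mem_spaceD_iff hN hs0 hs1 hp hps hβ0 hβ1]
  constructor
  · rintro ⟨hu, hl, he⟩
    have hg := (energy_lt_top_iff hp0 hu).1 he
    exact ⟨⟨hu, hg, ne_top_of_le_ne_top (by finiteness)
      (h u hu ((lpEnergy_lt_top_iff hp0 u).1 hl))⟩, hl⟩
  · rintro ⟨⟨hu, hg, -⟩, hl⟩
    exact ⟨hu, hl, (energy_lt_top_iff hp0 hu).2 hg⟩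

end FracSobolev

end

theorem mainTheorem2 (N : ℕ) (s p β : ℝ) (hs0 : 0 < s) (hs1 : s < 1) (hp : 1 < p)
    (hps : p * s < (N : ℝ)) (hβ0 : -(p * s) < β) (hβ1 : β < ((N : ℝ) - p * s) / 2) :
    (FracSobolev.spaceD N s p β = FracSobolev.spaceE N s p (-2 * β / p) ∧
      ∃ C₁ C₂ : ℝ, 0 < C₁ ∧ 0 < C₂ ∧ ∀ u ∈ FracSobolev.spaceE N s p (-2 * β / p),
        C₁ * FracSobolev.normE N s p (-2 * β / p) u ≤ FracSobolev.seminorm N s p β u ∧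
        FracSobolev.seminorm N s p β u ≤ C₂ * FracSobolev.normE N s p (-2 * β / p) u) ∧
    (FracSobolev.spaceW N s p β =
        {u | u ∈ FracSobolev.spaceE N s p (-2 * β / p) ∧ FracSobolev.lpEnergy N p β u < ⊤} ∧
      ∃ C₁ C₂ : ℝ, 0 < C₁ ∧ 0 < C₂ ∧ ∀ u ∈ FracSobolev.spaceW N s p β,
        C₁ * (FracSobolev.lpNorm N p β u + FracSobolev.normE N s p (-2 * β / p) u)
          ≤ FracSobolev.normW N s p β u ∧
        FracSobolev.normW N s p β u
          ≤ C₂ * (FracSobolev.lpNorm N p β u + FracSobolev.normE N s p (-2 * β / p) u)) := by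
  have hN : 1 ≤ N := by
    have : (0 : ℝ) < N := lt_trans (by positivity) hps
    exact_mod_cast this
  have hW := FracSobolev.spaceW_eq hN hs0 hs1 hp.le hps hβ0 hβ1
  obtain ⟨A, B, hA, hB, hAB⟩ :=
    FracSobolev.exists_norm_equivalence hN hs0 hs1 hp.le hps hβ0 hβ1
  have hA0 : 0 < A := by linarith
  refine ⟨⟨FracSobolev.spaceD_eq_spaceE hN hs0 hs1 hp.le hps hβ0 hβ1, A⁻¹, B, by positivity,
    by linarith, fun u hu => ⟨?_, (hAB u hu).2⟩⟩, hW, A⁻¹, B, by positivity, by linarith,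
    fun u hu => ?_⟩
  · rw [inv_mul_le_iff₀ hA0]
    exact (hAB u hu).1
  · rw [hW] at hu
    obtain ⟨h1, h2⟩ := hAB u hu.1
    have hl : 0 ≤ FracSobolev.lpNorm N p β u := Real.rpow_nonneg ENNReal.toReal_nonneg _
    rw [FracSobolev.normW, inv_mul_le_iff₀ hA0, mul_add, mul_add]
    exact ⟨add_le_add (le_mul_of_one_le_left hl hA) h1, add_le_add (le_mul_of_one_le_left hl hB) h2⟩
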